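/- Let $N$ be an Orlicz function, i.e. $N:[0,\infty)\to[0,\infty)$ is convex, continuous and (strictly) increasing, $N(0)=0$ and $\lim_{u\to\infty}N(u)=\infty$; let $N^{-1}:[0,\infty)\to[0,\infty)$ be its inverse function. Let $L_N$ be the Orlicz space of (classes of) measurable functions $x:(0,\infty)\to\mathbb R$ with finite norm $$\|x\|_{L_N}=\inf\Big\{u>0:\ \int_0^\infty N\big(|x(t)|/u\big)\,dt\le 1\Big\}.$$ Put $$\alpha_N=-\lim_{n\to\infty}\frac1n\log_2\sup_{k\in\mathbb Z}\frac{N^{-1}(2^{k-n})}{N^{-1}(2^k)},\qquad \beta_N=\lim_{n\to\infty}\frac1n\log_2\sup_{k\in\mathbb Z}\frac{N^{-1}(2^{k})}{N^{-1}(2^{k-n})},$$ $$\beta_N^0=\lim_{n\to\infty}\frac1n\log_2\sup_{k\ge 0}\frac{N^{-1}(2^{k+n})}{N^{-1}(2^{k})},\qquad \alpha_N^\infty=-\lim_{n\to\infty}\frac1n\log_2\sup_{k\le 0}\frac{N^{-1}(2^{k-n})}{N^{-1}(2^k)},$$ where $k$ runs over integers (these limits exist). Let $\mathcal F(L_N)$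 be the set of all $p\in[1,\infty]$ such that $\ell^p$ is symmetrically finitely represented in $L_N$: for every $n\in\mathbb N$ and $\varepsilon>0$ there are $x_1,\dots,x_n\in L_N$ with pairwise disjoint supports which are equimeasurable (i.e. $m\{s>0:|x_i(s)|>\tau\}=m\{s>0:|x_j(s)|>\tau\}$ for all $\tau>0$ and all $i,j$, with $m$ Lebesgue measure) such that $$(1+\varepsilon)^{-1}\|a\|_p\le\Big\|\sum_{k=1}^n a_kx_k\Big\|_{L_N}\le(1+\varepsilon)\|a\|_p\qquad\text{for all }a=(a_k)_{k=1}^n\in\mathbb R^n .$$ Suppose that $\alpha_N>0$. Then: (i) if $\alpha_N^\infty\le\beta_N^0$, then $\mathcal F(L_N)=[1/\beta_N,\,1/\alpha_N]$; (ii) if $\alpha_N^\infty>\beta_N^0$, then $\mathcal F(L_N)=[1/\beta_N,\,1/\alpha_N^\infty]\cup[1/\beta_N^0,\,1/\alpha_N]$. -/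

import Mathlib

open Set Filter Topology MeasureTheory
open scoped ENNReal

/-- An Orlicz function: a convex, continuous, (strictly) increasing function on `[0,∞)` with
`N(0) = 0` and `N(∞) = ∞`. Only the values of `N` on `[0,∞)` matter. -/
structure IsOrliczFunction (N : ℝ → ℝ) : Prop where
  convex : ConvexOn ℝ (Ici 0) N
  continuous : ContinuousOn N (Ici 0)
  increasing : StrictMonoOn N (Ici 0)
  map_zero : N 0 = 0
  tendsto_top : Tendsto N atTop atTop

/-- Lebesgue measure on `(0,∞)`. -/
noncomputable def halfLine : Measure ℝ := volume.restrict (Ioi 0)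

/-- The set of `u > 0` with `∫₀^∞ N(|x(t)|/u) dt ≤ 1`. -/
def luxemburgSet (N : ℝ → ℝ) (x : ℝ → ℝ) : Set ℝ :=
  {u : ℝ | 0 < u ∧ ∫⁻ t, ENNReal.ofReal (N (|x t| / u)) ∂halfLine ≤ 1}

/-- Membership in the Orlicz space `L_N` on `(0,∞)`: measurable with finite Luxemburg norm.
Functions stand for their classes modulo equality a.e. on `(0,∞)`. -/
def MemOrlicz (N : ℝ → ℝ) (x : ℝ → ℝ) : Prop :=
  AEMeasurable x halfLine ∧ (luxemburgSet N x).Nonempty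

/-- The Luxemburg norm of an element of `L_N`. -/
noncomputable def orliczNorm (N : ℝ → ℝ) (x : ℝ → ℝ) : ℝ := sInf (luxemburgSet N x)

/-- `m{s > 0 : |x(s)| > τ} = m{s > 0 : |y(s)| > τ}` for all `τ > 0`. -/
def Equimeasurable (x y : ℝ → ℝ) : Prop :=
  ∀ τ : ℝ, 0 < τ → halfLine {s | τ < |x s|} = halfLine {s | τ < |y s|}

/-- `x` and `y`, as classes of functions on `(0,∞)`, have disjoint supports. -/
def DisjointSupports (x y : ℝ → ℝ) : Prop := ∀ᵐ t ∂halfLine, x t = 0 ∨ y t = 0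

/-- `ℓ^p` is symmetrically finitely represented in `L_N`. -/
def SymmFinitelyRepresented (N : ℝ → ℝ) (p : ℝ≥0∞) : Prop :=
  ∀ (n : ℕ) (ε : ℝ), 0 < ε → ∃ x : Fin n → ℝ → ℝ,
    (∀ i, MemOrlicz N (x i)) ∧
    (∀ i j, Equimeasurable (x i) (x j)) ∧
    (∀ i j, i ≠ j → DisjointSupports (x i) (x j)) ∧
    ∀ a : Fin n → ℝ,
      (1 + ε)⁻¹ * ‖WithLp.toLp p a‖ ≤ orliczNorm N (fun t => ∑ k, a k * x k t) ∧
      orliczNorm N (fun t => ∑ k, a k * x k t) ≤ (1 + ε) * ‖WithLp.toLp p a‖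

/-- The set `𝓕(L_N)` of all `p ∈ [1,∞]` such that `ℓ^p` is symmetrically finitely
represented in `L_N`. -/
def symmReprSet (N : ℝ → ℝ) : Set ℝ≥0∞ := {p | 1 ≤ p ∧ SymmFinitelyRepresented N p}

/-- The inverse function `N⁻¹ : [0,∞) → [0,∞)`. -/
noncomputable def orliczInv (N : ℝ → ℝ) : ℝ → ℝ := Function.invFunOn N (Ici 0)

/-- `α_N = - lim (1/n) log₂ sup_{k ∈ ℤ} N⁻¹(2^(k-n)) / N⁻¹(2^k)`. -/
noncomputable def orliczAlpha (N : ℝ → ℝ) : ℝ :=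
  -limUnder atTop (fun n : ℕ => 1 / (n : ℝ) * Real.logb 2
    (⨆ k : ℤ, orliczInv N (2 ^ (k - (n : ℤ))) / orliczInv N (2 ^ k)))

/-- `β_N = lim (1/n) log₂ sup_{k ∈ ℤ} N⁻¹(2^k) / N⁻¹(2^(k-n))`. -/
noncomputable def orliczBeta (N : ℝ → ℝ) : ℝ :=
  limUnder atTop (fun n : ℕ => 1 / (n : ℝ) * Real.logb 2
    (⨆ k : ℤ, orliczInv N (2 ^ k) / orliczInv N (2 ^ (k - (n : ℤ)))))

/-- `β_N^0 = lim (1/n) log₂ sup_{k ≥ 0} N⁻¹(2^(k+n)) / N⁻¹(2^k)`. -/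
noncomputable def orliczBetaZero (N : ℝ → ℝ) : ℝ :=
  limUnder atTop (fun n : ℕ => 1 / (n : ℝ) * Real.logb 2
    (⨆ k : {k : ℤ // 0 ≤ k},
      orliczInv N (2 ^ ((k : ℤ) + (n : ℤ))) / orliczInv N (2 ^ (k : ℤ))))

/-- `α_N^∞ = - lim (1/n) log₂ sup_{k ≤ 0} N⁻¹(2^(k-n)) / N⁻¹(2^k)`. -/
noncomputable def orliczAlphaInfty (N : ℝ → ℝ) : ℝ :=
  -limUnder atTop (fun n : ℕ => 1 / (n : ℝ) * Real.logb 2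
    (⨆ k : {k : ℤ // k ≤ 0},
      orliczInv N (2 ^ ((k : ℤ) - (n : ℤ))) / orliczInv N (2 ^ (k : ℤ))))

/-! The limits in these definitions exist for every Orlicz function, and the suprema are of
bounded nonempty sets. -/

theorem orliczInv_spec {N : ℝ → ℝ} (hN : IsOrliczFunction N) {s : ℝ} (hs : 0 ≤ s) :
    0 ≤ orliczInv N s ∧ N (orliczInv N s) = s := by
  have hex : ∃ u ∈ Ici (0 : ℝ), N u = s := by
    obtain ⟨b, hb⟩ := (hN.tendsto_top.eventually_ge_atTop s).exists_forall_of_atTop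
    have hb' := hb (max b 0) (le_max_left _ _)
    have hc : ContinuousOn N (Icc 0 (max b 0)) :=
      hN.continuous.mono Icc_subset_Ici_self
    obtain ⟨u, hu, hu'⟩ := intermediate_value_Icc (le_max_right b 0) hc
      (show s ∈ Icc (N 0) (N (max b 0)) from ⟨by rw [hN.map_zero]; exact hs, hb'⟩)
    exact ⟨u, hu.1, hu'⟩
  exact ⟨Function.invFunOn_mem hex, Function.invFunOn_eq hex⟩

theorem orliczInv_pos {N : ℝ → ℝ} (hN : IsOrliczFunction N) {s : ℝ} (hs : 0 < s) :
    0 < orliczInv N s := by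
  obtain ⟨h1, h2⟩ := orliczInv_spec hN hs.le
  rcases h1.eq_or_lt with h | h
  · rw [← h, hN.map_zero] at h2
    exact absurd h2 hs.ne
  · exact h

theorem orliczInv_mono {N : ℝ → ℝ} (hN : IsOrliczFunction N) {s t : ℝ} (hs : 0 ≤ s)
    (hst : s ≤ t) : orliczInv N s ≤ orliczInv N t := by
  obtain ⟨h1, h2⟩ := orliczInv_spec hN hs
  obtain ⟨h3, h4⟩ := orliczInv_spec hN (hs.trans hst)
  by_contra! h
  have := hN.increasing h3 h1 h
  linarith

theorem orliczInv_mul_le {N : ℝ → ℝ} (hN : IsOrliczFunction N) {s c : ℝ} (hs : 0 ≤ s)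
    (hc : 1 ≤ c) : orliczInv N (c * s) ≤ c * orliczInv N s := by
  have hc0 : 0 < c := by linarith
  obtain ⟨h1, h2⟩ := orliczInv_spec hN hs
  obtain ⟨h3, h4⟩ := orliczInv_spec hN (mul_nonneg hc0.le hs)
  by_contra! h
  have h5 : orliczInv N s < c⁻¹ * orliczInv N (c * s) := by
    rw [inv_mul_eq_div, lt_div_iff₀ hc0]; linarith
  have h6 := hN.increasing h1 (mem_Ici.2 (h1.trans h5.le)) h5
  have h7 := hN.convex.2 (mem_Ici.2 h3) (mem_Ici.2 le_rfl) (inv_nonneg.2 hc0.le)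
    (sub_nonneg.2 (inv_le_one_of_one_le₀ hc)) (by ring)
  simp only [smul_eq_mul, mul_zero, add_zero, hN.map_zero, h4] at h7
  rw [h2] at h6
  rw [inv_mul_cancel_left₀ hc0.ne'] at h7
  linarith

theorem orlicz_ratio_bounds {N : ℝ → ℝ} (hN : IsOrliczFunction N) (k : ℤ) (n : ℕ) :
    0 < orliczInv N (2 ^ k) ∧ orliczInv N (2 ^ k) ≤ orliczInv N (2 ^ (k + (n : ℤ))) ∧
      orliczInv N (2 ^ (k + (n : ℤ))) ≤ 2 ^ n * orliczInv N (2 ^ k) := by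
  have h2 : (2 : ℝ) ^ (k + (n : ℤ)) = 2 ^ n * 2 ^ k := by
    rw [zpow_add₀ two_ne_zero, zpow_natCast, mul_comm]
  refine ⟨orliczInv_pos hN (by positivity), orliczInv_mono hN (by positivity) ?_, ?_⟩
  · exact zpow_le_zpow_right₀ one_le_two (by omega)
  · rw [h2]
    exact orliczInv_mul_le hN (by positivity) (one_le_pow₀ one_le_two)

/-- Existence of the limit for the supremum of a submultiplicative family of ratios. -/
theorem exists_tendsto_logb_iSup {ι : Type*} [Nonempty ι] (r : ι → ℕ → ℝ) {b C : ℝ}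
    (hb : 0 < b) (hlow : ∀ k n, b ^ n ≤ r k n) (hup : ∀ k n, r k n ≤ C ^ n)
    (hsub : ∀ k m n, ∃ k' k'', r k (m + n) = r k' m * r k'' n) :
    ∃ L : ℝ, Tendsto (fun n : ℕ => 1 / (n : ℝ) * Real.logb 2 (⨆ k, r k n)) atTop (𝓝 L) := by
  have hbdd : ∀ n, BddAbove (range fun k => r k n) := fun n =>
    ⟨C ^ n, by rintro _ ⟨k, rfl⟩; exact hup k n⟩
  have hge : ∀ n, b ^ n ≤ ⨆ k, r k n := fun n =>
    (hlow (Classical.arbitrary ι) n).trans (le_ciSup (hbdd n) _)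
  have hpos : ∀ n, 0 < ⨆ k, r k n := fun n => (pow_pos hb n).trans_le (hge n)
  have hS : Subadditive fun n : ℕ => Real.logb 2 (⨆ k, r k n) := by
    intro m n
    rw [← Real.logb_mul (hpos m).ne' (hpos n).ne']
    refine Real.logb_le_logb_of_le one_lt_two (hpos _) (ciSup_le fun k => ?_)
    obtain ⟨k', k'', h⟩ := hsub k m n
    rw [h]
    exact mul_le_mul (le_ciSup (hbdd m) k') (le_ciSup (hbdd n) k'')
      ((pow_pos hb n).le.trans (hlow _ _)) (hpos m).le
  have hB : BddBelow (range fun n : ℕ => Real.logb 2 (⨆ k, r k n) / n) := by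
    refine ⟨min 0 (Real.logb 2 b), ?_⟩
    rintro _ ⟨n, rfl⟩
    rcases Nat.eq_zero_or_pos n with rfl | hn
    · simp
    · refine (min_le_right _ _).trans ?_
      have hn' : (0 : ℝ) < n := Nat.cast_pos.2 hn
      show _ ≤ Real.logb 2 (⨆ k, r k n) / (n : ℝ)
      rw [le_div_iff₀ hn']
      have := Real.logb_le_logb_of_le one_lt_two (pow_pos hb n) (hge n)
      rw [Real.logb_pow] at this
      linarith
  refine ⟨hS.lim, (hS.tendsto_lim hB).congr fun n => ?_⟩
  rw [div_eq_mul_one_div, mul_comm]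

theorem tendsto_orliczAlpha {N : ℝ → ℝ} (hN : IsOrliczFunction N) :
    Tendsto (fun n : ℕ => 1 / (n : ℝ) * Real.logb 2
      (⨆ k : ℤ, orliczInv N (2 ^ (k - (n : ℤ))) / orliczInv N (2 ^ k))) atTop
      (𝓝 (-orliczAlpha N)) := by
  rw [orliczAlpha, neg_neg]
  refine tendsto_nhds_limUnder (exists_tendsto_logb_iSup (ι := ℤ)
    (fun k n => orliczInv N (2 ^ (k - (n : ℤ))) / orliczInv N (2 ^ k))
    (b := 1 / 2) (C := 1) (by norm_num) ?_ ?_ ?_)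
  · intro k n
    obtain ⟨h1, h2, h3⟩ := orlicz_ratio_bounds hN (k - n) n
    rw [sub_add_cancel] at h2 h3
    rw [one_div_pow, div_le_div_iff₀ (by positivity) (h1.trans_le h2)]
    linarith
  · intro k n
    obtain ⟨h1, h2, h3⟩ := orlicz_ratio_bounds hN (k - n) n
    rw [sub_add_cancel] at h2 h3
    rw [one_pow]
    exact div_le_one_of_le₀ h2 (h1.le.trans h2)
  · intro k m n
    refine ⟨k, k - m, ?_⟩
    have h1 := (orlicz_ratio_bounds hN (k - m) n).1
    push_cast
    rw [← sub_sub, mul_comm, div_mul_div_cancel₀ h1.ne']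

theorem tendsto_orliczAlphaInfty {N : ℝ → ℝ} (hN : IsOrliczFunction N) :
    Tendsto (fun n : ℕ => 1 / (n : ℝ) * Real.logb 2
      (⨆ k : {k : ℤ // k ≤ 0},
        orliczInv N (2 ^ ((k : ℤ) - (n : ℤ))) / orliczInv N (2 ^ (k : ℤ)))) atTop
      (𝓝 (-orliczAlphaInfty N)) := by
  rw [orliczAlphaInfty, neg_neg]
  have : Nonempty {k : ℤ // k ≤ 0} := ⟨⟨0, le_rfl⟩⟩
  refine tendsto_nhds_limUnder (exists_tendsto_logb_iSup (ι := {k : ℤ // k ≤ 0})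
    (fun k n => orliczInv N (2 ^ ((k : ℤ) - (n : ℤ))) / orliczInv N (2 ^ (k : ℤ)))
    (b := 1 / 2) (C := 1) (by norm_num) ?_ ?_ ?_)
  · rintro ⟨k, hk⟩ n
    obtain ⟨h1, h2, h3⟩ := orlicz_ratio_bounds hN (k - n) n
    rw [sub_add_cancel] at h2 h3
    rw [one_div_pow, div_le_div_iff₀ (by positivity) (h1.trans_le h2)]
    linarith
  · rintro ⟨k, hk⟩ n
    obtain ⟨h1, h2, h3⟩ := orlicz_ratio_bounds hN (k - n) n
    rw [sub_add_cancel] at h2 h3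
    rw [one_pow]
    exact div_le_one_of_le₀ h2 (h1.le.trans h2)
  · rintro ⟨k, hk⟩ m n
    refine ⟨⟨k, hk⟩, ⟨k - m, by omega⟩, ?_⟩
    have h1 := (orlicz_ratio_bounds hN (k - m) n).1
    push_cast
    rw [← sub_sub, mul_comm, div_mul_div_cancel₀ h1.ne']

theorem tendsto_orliczBeta {N : ℝ → ℝ} (hN : IsOrliczFunction N) :
    Tendsto (fun n : ℕ => 1 / (n : ℝ) * Real.logb 2
      (⨆ k : ℤ, orliczInv N (2 ^ k) / orliczInv N (2 ^ (k - (n : ℤ))))) atTop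
      (𝓝 (orliczBeta N)) := by
  refine tendsto_nhds_limUnder (exists_tendsto_logb_iSup (ι := ℤ)
    (fun k n => orliczInv N (2 ^ k) / orliczInv N (2 ^ (k - (n : ℤ))))
    (b := 1) (C := 2) one_pos ?_ ?_ ?_)
  · intro k n
    obtain ⟨h1, h2, h3⟩ := orlicz_ratio_bounds hN (k - n) n
    rw [sub_add_cancel] at h2 h3
    rw [one_pow]
    exact (one_le_div h1).2 h2
  · intro k n
    obtain ⟨h1, h2, h3⟩ := orlicz_ratio_bounds hN (k - n) n
    rw [sub_add_cancel] at h2 h3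
    exact (div_le_iff₀ h1).2 h3
  · intro k m n
    refine ⟨k, k - m, ?_⟩
    have h1 := (orlicz_ratio_bounds hN (k - m) n).1
    push_cast
    rw [← sub_sub, div_mul_div_cancel₀ h1.ne']

theorem tendsto_orliczBetaZero {N : ℝ → ℝ} (hN : IsOrliczFunction N) :
    Tendsto (fun n : ℕ => 1 / (n : ℝ) * Real.logb 2
      (⨆ k : {k : ℤ // 0 ≤ k},
        orliczInv N (2 ^ ((k : ℤ) + (n : ℤ))) / orliczInv N (2 ^ (k : ℤ)))) atTop
      (𝓝 (orliczBetaZero N)) := by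
  have : Nonempty {k : ℤ // 0 ≤ k} := ⟨⟨0, le_rfl⟩⟩
  refine tendsto_nhds_limUnder (exists_tendsto_logb_iSup (ι := {k : ℤ // 0 ≤ k})
    (fun k n => orliczInv N (2 ^ ((k : ℤ) + (n : ℤ))) / orliczInv N (2 ^ (k : ℤ)))
    (b := 1) (C := 2) one_pos ?_ ?_ ?_)
  · rintro ⟨k, hk⟩ n
    obtain ⟨h1, h2, h3⟩ := orlicz_ratio_bounds hN k n
    rw [one_pow]
    exact (one_le_div h1).2 h2
  · rintro ⟨k, hk⟩ n
    obtain ⟨h1, h2, h3⟩ := orlicz_ratio_bounds hN k n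
    exact (div_le_iff₀ h1).2 h3
  · rintro ⟨k, hk⟩ m n
    refine ⟨⟨k + n, by omega⟩, ⟨k, hk⟩, ?_⟩
    have h1 := (orlicz_ratio_bounds hN k n).1
    have h2 := (orlicz_ratio_bounds hN (k + n) m).1
    push_cast
    rw [div_mul_div_cancel₀ h2.ne', add_right_comm, add_assoc]

/-!
If `x` has modular `Φ s = ∫ N (s |x|)`, disjoint translates `x_k` of `x` satisfy
`‖∑ a_k x_k‖ ≤ 1` exactly when `∑ Φ |a_k| ≤ 1`, so `ℓ^p` is symmetrically finitely represented in
`L_N` as soon as `Φ s` can be brought uniformly close to `s ^ p` on `[0, 1]`. A cut-off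
`r^{-1/p}` does this when the integral of `N (r^{-1/p})` over a window `[A, B]` dwarfs its integrals
over windows of fixed ratio at `A` and at `B`: scaling the bump by `s` multiplies its modular by
`s ^ p` and shifts the window.

If there are no such windows, the integrals over consecutive windows of a fixed ratio form a
sequence on `ℤ` whose sums over intervals are controlled by the endpoint values. Such a sequence
grows geometrically, decays geometrically, or decays up to some index and grows from there on. In
terms of `N` this says `β_N < 1/p`, or `1/p < α_N`, or `β_N^0 < 1/p < α_N^∞`. In each of these cases
`l ^ (-p) * N (l t) + l ^ p * N (t / l)` exceeds any given multiple of `N t` for all large `l`,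
uniformly in `t`, which is incompatible with long equimeasurable disjoint sequences equivalent to
the basis of `ℓ^p`. For `p = ∞` bumps of constant height take over, and they work exactly when `N`
has no power-type upper bound, that is, when `α_N = 0`.
-/

section Growth

/-- `f` grows on `S` at least like the power `q`, up to a multiplicative constant. Together with
`UpperGrowth` this is the description of Matuszewska–Orlicz indices by power-type bounds. -/
def LowerGrowth (f : ℝ → ℝ) (S : Set ℝ) (q : ℝ) : Prop :=
  ∃ C > 0, ∀ s ∈ S, ∀ t ∈ S, s ≤ t → (t / s) ^ q * f s ≤ C * f t

/-- `f` grows on `S` at most like the power `q`, up to a multiplicative constant. -/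
def UpperGrowth (f : ℝ → ℝ) (S : Set ℝ) (q : ℝ) : Prop :=
  ∃ C > 0, ∀ s ∈ S, ∀ t ∈ S, s ≤ t → f t ≤ C * ((t / s) ^ q * f s)

/-- The union of the intervals `[a ^ i, a ^ j]` with `i, j ∈ K`, so that growth on this set can be
tested on the powers of `a` with exponents in `K`. -/
def zpowHull (a : ℝ) (K : Set ℤ) : Set ℝ :=
  {t | ∃ i ∈ K, ∃ j ∈ K, a ^ i ≤ t ∧ t ≤ a ^ j}

variable {f g : ℝ → ℝ} {S T : Set ℝ} {a q s t : ℝ} {K : Set ℤ}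

theorem LowerGrowth.mono (h : LowerGrowth f T q) (hST : S ⊆ T) : LowerGrowth f S q :=
  let ⟨C, hC, H⟩ := h
  ⟨C, hC, fun s hs t ht => H s (hST hs) t (hST ht)⟩

theorem UpperGrowth.mono (h : UpperGrowth f T q) (hST : S ⊆ T) : UpperGrowth f S q :=
  let ⟨C, hC, H⟩ := h
  ⟨C, hC, fun s hs t ht => H s (hST hs) t (hST ht)⟩

theorem LowerGrowth.preimage_mul {c A B : ℝ} (h : LowerGrowth f S q) (hc : 0 < c) (hA : 0 < A)
    (hB : 0 < B) (hfA : ∀ t ∈ S, f (c⁻¹ * t) ≤ A * f t) (hfB : ∀ t ∈ S, f t ≤ B * f (c⁻¹ * t))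
    (hS : S ⊆ Ioi 0) : LowerGrowth f {t | c * t ∈ S} q := by
  obtain ⟨C, hC, H⟩ := h
  refine ⟨A * C * B, by positivity, fun s hs t ht hst => ?_⟩
  have hs0 : 0 < s := (mul_pos_iff_of_pos_left hc).1 (hS hs)
  have hr : c * t / (c * s) = t / s := mul_div_mul_left _ _ hc.ne'
  have hfs := hfA _ hs
  have hft := hfB _ ht
  have hC' := H _ hs _ ht (by gcongr)
  rw [inv_mul_cancel_left₀ hc.ne'] at hfs hft
  rw [hr] at hC'
  have h0 : 0 ≤ (t / s) ^ q := Real.rpow_nonneg (div_nonneg (hs0.le.trans hst) hs0.le) q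
  calc (t / s) ^ q * f s ≤ A * ((t / s) ^ q * f (c * s)) := by
        rw [mul_left_comm]; gcongr
    _ ≤ A * (C * f (c * t)) := mul_le_mul_of_nonneg_left hC' hA.le
    _ ≤ A * (C * (B * f t)) := by gcongr
    _ = A * C * B * f t := by ring

theorem UpperGrowth.preimage_mul {c A B : ℝ} (h : UpperGrowth f S q) (hc : 0 < c) (hA : 0 < A)
    (hB : 0 < B) (hfA : ∀ t ∈ S, f (c⁻¹ * t) ≤ A * f t) (hfB : ∀ t ∈ S, f t ≤ B * f (c⁻¹ * t))
    (hS : S ⊆ Ioi 0) : UpperGrowth f {t | c * t ∈ S} q := by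
  obtain ⟨C, hC, H⟩ := h
  refine ⟨A * C * B, by positivity, fun s hs t ht hst => ?_⟩
  have hs0 : 0 < s := (mul_pos_iff_of_pos_left hc).1 (hS hs)
  have hr : c * t / (c * s) = t / s := mul_div_mul_left _ _ hc.ne'
  have hfs := hfB _ hs
  have hft := hfA _ ht
  have hC' := H _ hs _ ht (by gcongr)
  rw [inv_mul_cancel_left₀ hc.ne'] at hfs hft
  rw [hr] at hC'
  have h0 : 0 ≤ (t / s) ^ q := Real.rpow_nonneg (div_nonneg (hs0.le.trans hst) hs0.le) q
  calc f t ≤ A * (C * ((t / s) ^ q * f (c * s))) := hft.trans (by gcongr)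
    _ ≤ A * (C * ((t / s) ^ q * (B * f s))) := by gcongr
    _ = A * C * B * ((t / s) ^ q * f s) := by ring

theorem LowerGrowth.upperGrowth_of_rightInvOn (h : LowerGrowth f S q) (hq : 0 < q)
    (hfg : RightInvOn g f T) (hg : MonotoneOn g T) (hTS : MapsTo g T S) (hS : S ⊆ Ioi 0)
    (hT : T ⊆ Ioi 0) : UpperGrowth g T q⁻¹ := by
  obtain ⟨C, hC, H⟩ := h
  refine ⟨C ^ q⁻¹, by positivity, fun σ hσ τ hτ hστ => ?_⟩
  have hgσ : 0 < g σ := hS (hTS hσ)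
  have hgτ : 0 < g τ := hS (hTS hτ)
  have hσ0 : 0 < σ := hT hσ
  have hτ0 : 0 < τ := hT hτ
  have hpow : (g τ / g σ) ^ q ≤ C * (τ / σ) := by
    have := H _ (hTS hσ) _ (hTS hτ) (hg hσ hτ hστ)
    rw [hfg hσ, hfg hτ] at this
    rwa [← mul_div_assoc, le_div_iff₀ hσ0]
  have hratio : g τ / g σ ≤ (C * (τ / σ)) ^ q⁻¹ :=
    (Real.le_rpow_inv_iff_of_pos (by positivity) (by positivity) hq).2 hpow
  rw [Real.mul_rpow hC.le (by positivity), div_le_iff₀ hgσ] at hratio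
  linarith

theorem UpperGrowth.lowerGrowth_of_rightInvOn (h : UpperGrowth f S q) (hq : 0 < q)
    (hfg : RightInvOn g f T) (hg : MonotoneOn g T) (hTS : MapsTo g T S) (hS : S ⊆ Ioi 0)
    (hT : T ⊆ Ioi 0) : LowerGrowth g T q⁻¹ := by
  obtain ⟨C, hC, H⟩ := h
  refine ⟨C ^ q⁻¹, by positivity, fun σ hσ τ hτ hστ => ?_⟩
  have hgσ : 0 < g σ := hS (hTS hσ)
  have hgτ : 0 < g τ := hS (hTS hτ)
  have hσ0 : 0 < σ := hT hσ
  have hτ0 : 0 < τ := hT hτ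
  have hpow : τ / σ ≤ C * (g τ / g σ) ^ q := by
    have := H _ (hTS hσ) _ (hTS hτ) (hg hσ hτ hστ)
    rw [hfg hσ, hfg hτ] at this
    rw [div_le_iff₀ hσ0]
    linarith
  have hratio : (τ / σ) ^ q⁻¹ ≤ C ^ q⁻¹ * (g τ / g σ) := by
    calc (τ / σ) ^ q⁻¹ ≤ (C * (g τ / g σ) ^ q) ^ q⁻¹ := by gcongr
      _ = C ^ q⁻¹ * (g τ / g σ) := by
        rw [Real.mul_rpow hC.le (by positivity), Real.rpow_rpow_inv (by positivity) hq.ne']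
  rwa [← mul_div_assoc, le_div_iff₀ hgσ] at hratio

theorem zpow_mem_zpowHull {i : ℤ} (hi : i ∈ K) : a ^ i ∈ zpowHull a K :=
  ⟨i, hi, i, hi, le_rfl, le_rfl⟩

theorem zpowHull_subset_Ioi (ha : 0 < a) : zpowHull a K ⊆ Ioi 0 := by
  rintro t ⟨i, -, -, -, hit, -⟩
  exact (zpow_pos ha i).trans_le hit

theorem exists_zpow_le_lt_of_mem_zpowHull (ha : 1 < a) (hK : K.OrdConnected)
    (ht : t ∈ zpowHull a K) : ∃ k ∈ K, a ^ k ≤ t ∧ t < a ^ (k + 1) := by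
  obtain ⟨k, hkt, htk⟩ := exists_mem_Ico_zpow (zpowHull_subset_Ioi (one_pos.trans ha) ht) ha
  obtain ⟨i, hi, j, hj, hit, htj⟩ := ht
  have hik := (zpow_lt_zpow_iff_right₀ ha).1 (hit.trans_lt htk)
  have hkj := (zpow_le_zpow_iff_right₀ ha).1 (hkt.trans htj)
  exact ⟨k, hK.out hi hj ⟨by omega, hkj⟩, hkt, htk⟩

theorem exists_zpow_lt_le_of_mem_zpowHull (ha : 1 < a) (hK : K.OrdConnected)
    (ht : t ∈ zpowHull a K) : ∃ k ∈ K, a ^ (k - 1) < t ∧ t ≤ a ^ k := by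
  obtain ⟨k, hkt, htk⟩ := exists_mem_Ioc_zpow (zpowHull_subset_Ioi (one_pos.trans ha) ht) ha
  obtain ⟨i, hi, j, hj, hit, htj⟩ := ht
  have hik := (zpow_le_zpow_iff_right₀ ha).1 (hit.trans htk)
  have hkj := (zpow_lt_zpow_iff_right₀ ha).1 (hkt.trans_le htj)
  exact ⟨k + 1, hK.out hi hj ⟨hik, by omega⟩, by simpa using hkt, htk⟩

theorem zpowHull_univ (ha : 1 < a) : zpowHull a univ = Ioi 0 := by
  refine (zpowHull_subset_Ioi (one_pos.trans ha)).antisymm fun t ht => ?_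
  obtain ⟨k, hkt, htk⟩ := exists_mem_Ico_zpow ht ha
  exact ⟨k, mem_univ _, k + 1, mem_univ _, hkt, htk.le⟩

theorem zpowHull_Ici (ha : 1 < a) (m : ℤ) : zpowHull a (Ici m) = Ici (a ^ m) := by
  ext t
  refine ⟨?_, fun ht => ?_⟩
  · rintro ⟨i, hi, -, -, hit, -⟩
    exact (zpow_le_zpow_right₀ ha.le hi).trans hit
  · obtain ⟨k, -, htk⟩ := exists_mem_Ioc_zpow ((zpow_pos (one_pos.trans ha) m).trans_le ht) ha
    exact ⟨m, mem_Ici.2 le_rfl, k + 1,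
      (zpow_le_zpow_iff_right₀ ha).1 ((mem_Ici.1 ht).trans htk), ht, htk⟩

theorem zpowHull_Iic (ha : 1 < a) (m : ℤ) : zpowHull a (Iic m) = Ioc 0 (a ^ m) := by
  ext t
  refine ⟨fun ht => ⟨zpowHull_subset_Ioi (one_pos.trans ha) ht, ?_⟩, fun ht => ?_⟩
  · obtain ⟨-, -, j, hj, -, htj⟩ := ht
    exact htj.trans (zpow_le_zpow_right₀ ha.le hj)
  · obtain ⟨k, hkt, -⟩ := exists_mem_Ico_zpow ht.1 ha
    exact ⟨k, (zpow_le_zpow_iff_right₀ ha).1 (hkt.trans ht.2), m, mem_Iic.2 le_rfl, hkt, ht.2⟩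

theorem zpow_add_natCast_div_zpow_rpow (ha : 0 < a) (i : ℤ) (n : ℕ) :
    (a ^ (i + n) / a ^ i) ^ q = (a ^ q) ^ n := by
  rw [zpow_add₀ ha.ne', mul_div_cancel_left₀ _ (zpow_pos ha i).ne', zpow_natCast,
    Real.rpow_pow_comm ha.le]

theorem pow_le_div_rpow_of_zpow (ha : 1 < a) (hq : 0 ≤ q) {i : ℤ} {n : ℕ} (hs : 0 < s)
    (hsi : s < a ^ (i + 1)) (hit : a ^ (i + n - 1) < t) :
    (a ^ q) ^ n ≤ (a ^ q) ^ 2 * (t / s) ^ q := by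
  have ha0 : 0 < a := one_pos.trans ha
  have ht : 0 < t := (zpow_pos ha0 _).trans hit
  rw [zpow_sub_one₀ ha0.ne', ← div_eq_mul_inv, div_lt_iff₀ ha0, zpow_add₀ ha0.ne',
    zpow_natCast] at hit
  rw [zpow_add_one₀ ha0.ne'] at hsi
  rw [Real.rpow_pow_comm ha0.le, Real.rpow_pow_comm ha0.le,
    ← Real.mul_rpow (by positivity) (by positivity)]
  gcongr
  rw [← mul_div_assoc, le_div_iff₀ hs]
  refine le_of_mul_le_mul_left ?_ (zpow_pos ha0 i)
  calc a ^ i * (a ^ n * s) = a ^ i * a ^ n * s := by ring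
    _ ≤ t * a * (a ^ i * a) := by gcongr
    _ = a ^ i * (a ^ 2 * t) := by ring

theorem div_rpow_le_pow_of_zpow (ha : 1 < a) (hq : 0 ≤ q) {i j : ℤ} {n : ℕ} (ht : 0 < t)
    (his : a ^ (i - 1) < s) (htj : t < a ^ (j + 1)) (hj : j ≤ i + n) :
    (t / s) ^ q ≤ (a ^ q) ^ 2 * (a ^ q) ^ n := by
  have ha0 : 0 < a := one_pos.trans ha
  have hs : 0 < s := (zpow_pos ha0 _).trans his
  rw [zpow_sub_one₀ ha0.ne', ← div_eq_mul_inv, div_lt_iff₀ ha0] at his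
  have hta : t ≤ a ^ i * a ^ (n + 1) := by
    rw [← zpow_natCast, ← zpow_add₀ ha0.ne']
    exact htj.le.trans (zpow_le_zpow_right₀ ha.le (by push_cast; omega))
  rw [← pow_add, Real.rpow_pow_comm ha0.le]
  gcongr
  rw [div_le_iff₀ hs]
  calc t ≤ s * a * a ^ (n + 1) := hta.trans (by gcongr)
    _ = a ^ (2 + n) * s := by ring

theorem upperGrowth_zpowHull_iff (ha : 1 < a) (hK : K.OrdConnected) (hf : MonotoneOn f (Ioi 0))
    (hf0 : ∀ t > 0, 0 ≤ f t) (hq : 0 ≤ q) :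
    UpperGrowth f (zpowHull a K) q ↔
      ∃ C > 0, ∀ i ∈ K, ∀ n : ℕ, i + n ∈ K → f (a ^ (i + n)) ≤ C * (a ^ q) ^ n * f (a ^ i) := by
  have ha0 : 0 < a := one_pos.trans ha
  constructor
  · rintro ⟨C, hC, H⟩
    refine ⟨C, hC, fun i hi n hn => ?_⟩
    have := H _ (zpow_mem_zpowHull hi) _ (zpow_mem_zpowHull hn)
      (zpow_le_zpow_right₀ ha.le (by omega))
    rwa [zpow_add_natCast_div_zpow_rpow ha0, ← mul_assoc] at this
  · rintro ⟨C, hC, H⟩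
    refine ⟨C * (a ^ q) ^ 2, by positivity, fun s hs t ht hst => ?_⟩
    have hs0 : 0 < s := zpowHull_subset_Ioi ha0 hs
    have ht0 : 0 < t := zpowHull_subset_Ioi ha0 ht
    obtain ⟨i, hi, his, hsi⟩ := exists_zpow_le_lt_of_mem_zpowHull ha hK hs
    obtain ⟨j, hj, hjt, htj⟩ := exists_zpow_lt_le_of_mem_zpowHull ha hK ht
    obtain ⟨n, rfl⟩ := Int.le.dest ((zpow_le_zpow_iff_right₀ ha).1 (his.trans (hst.trans htj)))
    have hfi : 0 ≤ f (a ^ i) := hf0 _ (zpow_pos ha0 i)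
    calc f t ≤ f (a ^ (i + n)) := hf ht0 (zpow_pos ha0 _) htj
      _ ≤ C * (a ^ q) ^ n * f (a ^ i) := H i hi n hj
      _ ≤ C * ((a ^ q) ^ 2 * (t / s) ^ q) * f s := by
        gcongr ?_ * ?_ * ?_
        exacts [pow_le_div_rpow_of_zpow ha hq hs0 hsi hjt, hf (zpow_pos ha0 i) hs0 his]
      _ = C * (a ^ q) ^ 2 * ((t / s) ^ q * f s) := by ring

theorem lowerGrowth_zpowHull_iff (ha : 1 < a) (hK : K.OrdConnected) (hf : MonotoneOn f (Ioi 0))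
    (hf0 : ∀ t > 0, 0 ≤ f t) (hq : 0 ≤ q) :
    LowerGrowth f (zpowHull a K) q ↔
      ∃ C > 0, ∀ i ∈ K, ∀ n : ℕ, i + n ∈ K → (a ^ q) ^ n * f (a ^ i) ≤ C * f (a ^ (i + n)) := by
  have ha0 : 0 < a := one_pos.trans ha
  constructor
  · rintro ⟨C, hC, H⟩
    refine ⟨C, hC, fun i hi n hn => ?_⟩
    have := H _ (zpow_mem_zpowHull hi) _ (zpow_mem_zpowHull hn)
      (zpow_le_zpow_right₀ ha.le (by omega))
    rwa [zpow_add_natCast_div_zpow_rpow ha0] at this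
  · rintro ⟨C, hC, H⟩
    refine ⟨(a ^ q) ^ 2 * max C 1, by positivity, fun s hs t ht hst => ?_⟩
    have hs0 : 0 < s := zpowHull_subset_Ioi ha0 hs
    have ht0 : 0 < t := zpowHull_subset_Ioi ha0 ht
    have hfs : 0 ≤ f s := hf0 s hs0
    have hft : 0 ≤ f t := hf0 t ht0
    obtain ⟨i, hi, his, hsi⟩ := exists_zpow_lt_le_of_mem_zpowHull ha hK hs
    obtain ⟨j, hj, hjt, htj⟩ := exists_zpow_le_lt_of_mem_zpowHull ha hK ht
    rw [mul_assoc]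
    rcases le_or_gt i j with hij | hji
    · obtain ⟨n, rfl⟩ := Int.le.dest hij
      calc (t / s) ^ q * f s ≤ (a ^ q) ^ 2 * (a ^ q) ^ n * f (a ^ i) := by
            gcongr ?_ * ?_
            exacts [div_rpow_le_pow_of_zpow ha hq ht0 his htj le_rfl, hf hs0 (zpow_pos ha0 i) hsi]
        _ ≤ (a ^ q) ^ 2 * (C * f (a ^ (i + n))) := by
            rw [mul_assoc]
            exact mul_le_mul_of_nonneg_left (H i hi n hj) (by positivity)
        _ ≤ (a ^ q) ^ 2 * (C * f t) := by
            gcongr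
            exact hf (zpow_pos ha0 _) ht0 hjt
        _ ≤ (a ^ q) ^ 2 * (max C 1 * f t) := by gcongr; exact le_max_left _ _
    · have hpow := div_rpow_le_pow_of_zpow (n := 0) ha hq ht0 his htj (by simpa using hji.le)
      rw [pow_zero, mul_one] at hpow
      calc (t / s) ^ q * f s ≤ (a ^ q) ^ 2 * (1 * f t) := by
            rw [one_mul]
            gcongr
            exact hf hs0 ht0 hst
        _ ≤ (a ^ q) ^ 2 * (max C 1 * f t) := by gcongr; exact le_max_right _ _

end Growth

section Indices

theorem exists_forall_le_mul_pow_of_tendsto_logb_iSup {ι : Type*} [Nonempty ι] {r : ι → ℕ → ℝ}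
    (hbdd : ∀ n, BddAbove (range fun k => r k n)) (hpos : ∀ k n, 0 < r k n) {x z : ℝ}
    (hlim : Tendsto (fun n : ℕ => 1 / (n : ℝ) * Real.logb 2 (⨆ k, r k n)) atTop (𝓝 x))
    (hxz : x < z) : ∃ C > 0, ∀ k n, r k n ≤ C * ((2 : ℝ) ^ z) ^ n := by
  have hsup : ∀ n, 0 < ⨆ k, r k n := fun n =>
    (hpos (Classical.arbitrary ι) n).trans_le (le_ciSup (hbdd n) _)
  obtain ⟨n₀, hn₀⟩ := ((hlim.eventually_lt_const hxz).and
    (eventually_gt_atTop 0)).exists_forall_of_atTop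
  set u : ℕ → ℝ := fun n => (⨆ k, r k n) / ((2 : ℝ) ^ z) ^ n
  have hu0 : ∀ n, 0 ≤ u n := fun n => div_nonneg (hsup n).le (by positivity)
  have hsum : 0 ≤ ∑ n ∈ Finset.range n₀, u n := Finset.sum_nonneg fun n _ => hu0 n
  refine ⟨1 + ∑ n ∈ Finset.range n₀, u n, by positivity, fun k n =>
    (le_ciSup (hbdd n) k).trans ?_⟩
  rw [← div_le_iff₀ (by positivity)]
  rcases lt_or_ge n n₀ with h | h
  · have := Finset.single_le_sum (fun n _ => hu0 n) (Finset.mem_range.2 h)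
    linarith
  · obtain ⟨hlog, hn⟩ := hn₀ n h
    rw [one_div_mul_eq_div, div_lt_iff₀ (Nat.cast_pos.2 hn),
      Real.logb_lt_iff_lt_rpow one_lt_two (hsup n), Real.rpow_mul_natCast zero_le_two] at hlog
    have := (div_le_one (by positivity)).2 hlog.le
    linarith

theorem le_of_tendsto_logb_iSup {ι : Type*} [Nonempty ι] {r : ι → ℕ → ℝ}
    (hpos : ∀ k n, 0 < r k n) {x z C : ℝ} (hC : 0 < C)
    (hlim : Tendsto (fun n : ℕ => 1 / (n : ℝ) * Real.logb 2 (⨆ k, r k n)) atTop (𝓝 x))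
    (hr : ∀ k n, r k n ≤ C * ((2 : ℝ) ^ z) ^ n) : x ≤ z := by
  have hbound : Tendsto (fun n : ℕ => 1 / (n : ℝ) * Real.logb 2 C + z) atTop (𝓝 z) := by
    simpa using (tendsto_one_div_atTop_nhds_zero_nat (𝕜 := ℝ)).mul_const (Real.logb 2 C)
      |>.add_const z
  refine le_of_tendsto_of_tendsto hlim hbound ?_
  filter_upwards [eventually_gt_atTop 0] with n hn
  have : (0 : ℝ) < n := Nat.cast_pos.2 hn
  have hsup : 0 < ⨆ k, r k n := (hpos (Classical.arbitrary ι) n).trans_le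
    (le_ciSup ⟨_, forall_mem_range.2 fun k => hr k n⟩ _)
  have hlog := Real.logb_le_logb_of_le one_lt_two hsup (ciSup_le fun k => hr k n)
  rw [Real.logb_mul hC.ne' (by positivity), Real.logb_pow,
    Real.logb_rpow two_pos one_lt_two.ne'] at hlog
  calc 1 / (n : ℝ) * Real.logb 2 (⨆ k, r k n)
      ≤ 1 / (n : ℝ) * (Real.logb 2 C + n * z) := by gcongr
    _ = 1 / (n : ℝ) * Real.logb 2 C + z := by field_simp

variable {N : ℝ → ℝ}

theorem IsOrliczFunction.mono (hN : IsOrliczFunction N) {s t : ℝ} (hs : 0 ≤ s) (hst : s ≤ t) :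
    N s ≤ N t :=
  hN.increasing.monotoneOn hs (hs.trans hst) hst

theorem IsOrliczFunction.pos (hN : IsOrliczFunction N) {t : ℝ} (ht : 0 < t) : 0 < N t :=
  hN.map_zero ▸ hN.increasing self_mem_Ici (mem_Ici.2 ht.le) ht

theorem IsOrliczFunction.nonneg (hN : IsOrliczFunction N) {t : ℝ} (ht : 0 ≤ t) : 0 ≤ N t :=
  hN.map_zero ▸ hN.mono le_rfl ht

theorem orliczInv_apply (hN : IsOrliczFunction N) {t : ℝ} (ht : 0 ≤ t) :
    orliczInv N (N t) = t :=
  hN.increasing.injOn.leftInvOn_invFunOn ht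

theorem monotoneOn_orliczInv (hN : IsOrliczFunction N) : MonotoneOn (orliczInv N) (Ioi 0) :=
  fun _ hs _ _ => orliczInv_mono hN (le_of_lt hs)

theorem orliczInv_mul_le_max (hN : IsOrliczFunction N) {c s : ℝ} (hc : 0 ≤ c) (hs : 0 ≤ s) :
    orliczInv N (c * s) ≤ max c 1 * orliczInv N s := by
  calc orliczInv N (c * s) ≤ orliczInv N (max c 1 * s) :=
        orliczInv_mono hN (by positivity) (by gcongr; exact le_max_left _ _)
    _ ≤ max c 1 * orliczInv N s := orliczInv_mul_le hN hs (le_max_right _ _)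

theorem orliczInv_le_max_mul (hN : IsOrliczFunction N) {c s : ℝ} (hc : 0 < c) (hs : 0 ≤ s) :
    orliczInv N s ≤ max c 1 * orliczInv N (c⁻¹ * s) := by
  simpa only [mul_inv_cancel_left₀ hc.ne'] using
    orliczInv_mul_le_max hN hc.le (mul_nonneg (inv_nonneg.2 hc.le) hs)

theorem UpperGrowth.orliczInv_preimage_mul (hN : IsOrliczFunction N) {S : Set ℝ} {q c : ℝ}
    (h : UpperGrowth (orliczInv N) S q) (hS : S ⊆ Ioi 0) (hc : 0 < c) :
    UpperGrowth (orliczInv N) {t | c * t ∈ S} q :=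
  h.preimage_mul hc (by positivity) (by positivity)
    (fun _ ht => orliczInv_mul_le_max hN (inv_nonneg.2 hc.le) (hS ht).le)
    (fun _ ht => orliczInv_le_max_mul hN hc (hS ht).le) hS

theorem LowerGrowth.orliczInv_preimage_mul (hN : IsOrliczFunction N) {S : Set ℝ} {q c : ℝ}
    (h : LowerGrowth (orliczInv N) S q) (hS : S ⊆ Ioi 0) (hc : 0 < c) :
    LowerGrowth (orliczInv N) {t | c * t ∈ S} q :=
  h.preimage_mul hc (by positivity) (by positivity)
    (fun _ ht => orliczInv_mul_le_max hN (inv_nonneg.2 hc.le) (hS ht).le)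
    (fun _ ht => orliczInv_le_max_mul hN hc (hS ht).le) hS

theorem UpperGrowth.orliczInv_Ici (hN : IsOrliczFunction N) {q τ τ' : ℝ} (hτ : 0 < τ)
    (hτ' : 0 < τ') (h : UpperGrowth (orliczInv N) (Ici τ) q) :
    UpperGrowth (orliczInv N) (Ici τ') q :=
  (h.orliczInv_preimage_mul hN (Ici_subset_Ioi.2 hτ) (div_pos hτ hτ')).mono fun t ht => by
    rw [mem_ofPred_eq, mem_Ici, div_mul_eq_mul_div, le_div_iff₀ hτ']
    exact mul_le_mul_of_nonneg_left ht hτ.le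

theorem LowerGrowth.orliczInv_Ioc (hN : IsOrliczFunction N) {q τ τ' : ℝ} (hτ : 0 < τ)
    (hτ' : 0 < τ') (h : LowerGrowth (orliczInv N) (Ioc 0 τ) q) :
    LowerGrowth (orliczInv N) (Ioc 0 τ') q :=
  (h.orliczInv_preimage_mul hN Ioc_subset_Ioi_self (div_pos hτ hτ')).mono fun t ht => by
    refine ⟨mul_pos (div_pos hτ hτ') ht.1, ?_⟩
    rw [div_mul_eq_mul_div, div_le_iff₀ hτ']
    exact mul_le_mul_of_nonneg_left ht.2 hτ.le

theorem IsOrliczFunction.rightInvOn_orliczInv (hN : IsOrliczFunction N) :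
    RightInvOn (orliczInv N) N (Ici 0) :=
  fun _ ht => (orliczInv_spec hN ht).2

theorem IsOrliczFunction.image_Ioi (hN : IsOrliczFunction N) : N '' Ioi 0 = Ioi 0 :=
  (image_subset_iff.2 fun _ => hN.pos).antisymm fun _ ht =>
    ⟨_, orliczInv_pos hN ht, hN.rightInvOn_orliczInv (mem_Ici.2 (le_of_lt ht))⟩

theorem IsOrliczFunction.image_Ici (hN : IsOrliczFunction N) {t₀ : ℝ} (ht₀ : 0 ≤ t₀) :
    N '' Ici t₀ = Ici (N t₀) := by
  refine (image_subset_iff.2 fun _ => hN.mono ht₀).antisymm fun t ht => ?_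
  have := orliczInv_mono hN (hN.nonneg ht₀) ht
  rw [orliczInv_apply hN ht₀] at this
  exact ⟨_, this, hN.rightInvOn_orliczInv ((hN.nonneg ht₀).trans ht)⟩

theorem IsOrliczFunction.image_Ioc (hN : IsOrliczFunction N) {t₀ : ℝ} (ht₀ : 0 ≤ t₀) :
    N '' Ioc 0 t₀ = Ioc 0 (N t₀) := by
  have hmaps : MapsTo N (Ioc 0 t₀) (Ioc 0 (N t₀)) := fun t ht =>
    ⟨hN.pos ht.1, hN.mono ht.1.le ht.2⟩
  refine hmaps.image_subset.antisymm fun t ht => ?_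
  have := orliczInv_mono hN ht.1.le ht.2
  rw [orliczInv_apply hN ht₀] at this
  exact ⟨_, ⟨orliczInv_pos hN ht.1, this⟩, hN.rightInvOn_orliczInv ht.1.le⟩

theorem IsOrliczFunction.lowerGrowth_iff (hN : IsOrliczFunction N) {S : Set ℝ}
    (hS : S ⊆ Ioi 0) {q : ℝ} (hq : 0 < q) :
    LowerGrowth N S q ↔ UpperGrowth (orliczInv N) (N '' S) q⁻¹ := by
  have hNS : N '' S ⊆ Ioi 0 := image_subset_iff.2 fun t ht => hN.pos (hS ht)
  refine ⟨fun h => h.upperGrowth_of_rightInvOn hq ?_ ?_ ?_ hS hNS, fun h => ?_⟩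
  · exact hN.rightInvOn_orliczInv.mono (hNS.trans Ioi_subset_Ici_self)
  · exact (monotoneOn_orliczInv hN).mono hNS
  · rintro _ ⟨t, ht, rfl⟩
    rwa [orliczInv_apply hN (hS ht).le]
  · have hinv : RightInvOn N (orliczInv N) S := fun t ht => orliczInv_apply hN (hS ht).le
    simpa using h.lowerGrowth_of_rightInvOn (inv_pos.2 hq) hinv
      (hN.increasing.monotoneOn.mono (hS.trans Ioi_subset_Ici_self)) (mapsTo_image N S) hNS hS

theorem IsOrliczFunction.upperGrowth_iff (hN : IsOrliczFunction N) {S : Set ℝ}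
    (hS : S ⊆ Ioi 0) {q : ℝ} (hq : 0 < q) :
    UpperGrowth N S q ↔ LowerGrowth (orliczInv N) (N '' S) q⁻¹ := by
  have hNS : N '' S ⊆ Ioi 0 := image_subset_iff.2 fun t ht => hN.pos (hS ht)
  refine ⟨fun h => h.lowerGrowth_of_rightInvOn hq ?_ ?_ ?_ hS hNS, fun h => ?_⟩
  · exact hN.rightInvOn_orliczInv.mono (hNS.trans Ioi_subset_Ici_self)
  · exact (monotoneOn_orliczInv hN).mono hNS
  · rintro _ ⟨t, ht, rfl⟩
    rwa [orliczInv_apply hN (hS ht).le]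
  · have hinv : RightInvOn N (orliczInv N) S := fun t ht => orliczInv_apply hN (hS ht).le
    simpa using h.upperGrowth_of_rightInvOn (inv_pos.2 hq) hinv
      (hN.increasing.monotoneOn.mono (hS.trans Ioi_subset_Ici_self)) (mapsTo_image N S) hNS hS

/-- The quotients `N⁻¹(2^(i+n)) / N⁻¹(2^i)` with both `i` and `i + n` in `K`: the families of
quotients defining the four indices are these for `K = ℤ`, `{k ≥ 0}`, `{k ≤ 0}`, and their
inverses. -/
def orliczInvRatios (N : ℝ → ℝ) (K : Set ℤ) (n : ℕ) : Set ℝ :=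
  (fun i : ℤ => orliczInv N (2 ^ (i + n)) / orliczInv N (2 ^ i)) '' {i | i ∈ K ∧ i + n ∈ K}

theorem orliczInvRatios_subset_Icc (hN : IsOrliczFunction N) (K : Set ℤ) (n : ℕ) :
    orliczInvRatios N K n ⊆ Icc 1 (2 ^ n) := by
  rintro _ ⟨i, -, rfl⟩
  obtain ⟨hpos, hmono, hle⟩ := orlicz_ratio_bounds hN i n
  exact ⟨(one_le_div hpos).2 hmono, (div_le_iff₀ hpos).2 hle⟩

theorem upperGrowth_orliczInv_iff (hN : IsOrliczFunction N) {K : Set ℤ} (hK : K.OrdConnected)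
    {z : ℝ} (hz : 0 ≤ z) :
    UpperGrowth (orliczInv N) (zpowHull 2 K) z ↔
      ∃ C > 0, ∀ n, ∀ ρ ∈ orliczInvRatios N K n, ρ ≤ C * ((2 : ℝ) ^ z) ^ n := by
  rw [upperGrowth_zpowHull_iff one_lt_two hK (monotoneOn_orliczInv hN)
    (fun t ht => (orliczInv_pos hN ht).le) hz]
  simp only [orliczInvRatios, forall_mem_image, mem_ofPred_eq, and_imp,
    div_le_iff₀ (orliczInv_pos hN (zpow_pos two_pos _))]
  exact exists_congr fun C => and_congr_right fun _ =>
    ⟨fun H n i hi hn => H i hi n hn, fun H i hi n hn => H n hi hn⟩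

theorem lowerGrowth_orliczInv_iff (hN : IsOrliczFunction N) {K : Set ℤ} (hK : K.OrdConnected)
    {z : ℝ} (hz : 0 ≤ z) :
    LowerGrowth (orliczInv N) (zpowHull 2 K) z ↔
      ∃ C > 0, ∀ n, ∀ ρ ∈ orliczInvRatios N K n, ρ⁻¹ ≤ C * ((2 : ℝ) ^ (-z)) ^ n := by
  rw [lowerGrowth_zpowHull_iff one_lt_two hK (monotoneOn_orliczInv hN)
    (fun t ht => (orliczInv_pos hN ht).le) hz]
  have hpow : ∀ n : ℕ, 0 < ((2 : ℝ) ^ z) ^ n := fun n => by positivity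
  simp only [orliczInvRatios, forall_mem_image, mem_ofPred_eq, and_imp, inv_div,
    div_le_iff₀ (orliczInv_pos hN (zpow_pos two_pos _)), Real.rpow_neg zero_le_two, inv_pow,
    ← div_eq_mul_inv, div_mul_eq_mul_div, le_div_iff₀ (hpow _), mul_comm (((2 : ℝ) ^ z) ^ _)]
  exact exists_congr fun C => and_congr_right fun _ =>
    ⟨fun H n i hi hn => H i hi n hn, fun H i hi n hn => H n hi hn⟩

theorem lt_iff_exists_upperGrowth_orliczInv (hN : IsOrliczFunction N) {K : Set ℤ}
    (hK : K.OrdConnected) {ι : Type*} [Nonempty ι] {r : ι → ℕ → ℝ}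
    (hr : ∀ n, range (fun k => r k n) = orliczInvRatios N K n) {x y : ℝ} (hy : 0 < y)
    (hlim : Tendsto (fun n : ℕ => 1 / (n : ℝ) * Real.logb 2 (⨆ k, r k n)) atTop (𝓝 x)) :
    x < y ↔ ∃ z, 0 < z ∧ z < y ∧ UpperGrowth (orliczInv N) (zpowHull 2 K) z := by
  have hIcc : ∀ k n, r k n ∈ Icc 1 (2 ^ n) := fun k n =>
    orliczInvRatios_subset_Icc hN K n (hr n ▸ mem_range_self k)
  have hpos : ∀ k n, 0 < r k n := fun k n => one_pos.trans_le (hIcc k n).1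
  constructor
  · intro hxy
    obtain ⟨z, hz, hzy⟩ := exists_between (max_lt hxy hy)
    have hz0 : 0 < z := (le_max_right _ _).trans_lt hz
    obtain ⟨C, hC, H⟩ := exists_forall_le_mul_pow_of_tendsto_logb_iSup
      (fun n => ⟨2 ^ n, forall_mem_range.2 fun k => (hIcc k n).2⟩) hpos hlim
      ((le_max_left _ _).trans_lt hz)
    refine ⟨z, hz0, hzy, (upperGrowth_orliczInv_iff hN hK hz0.le).2 ⟨C, hC, fun n => ?_⟩⟩
    rw [← hr n, forall_mem_range]
    exact fun k => H k n
  · rintro ⟨z, hz0, hzy, h⟩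
    obtain ⟨C, hC, H⟩ := (upperGrowth_orliczInv_iff hN hK hz0.le).1 h
    exact (le_of_tendsto_logb_iSup hpos hC hlim fun k n =>
      H n _ (hr n ▸ mem_range_self k)).trans_lt hzy

theorem lt_neg_iff_exists_lowerGrowth_orliczInv (hN : IsOrliczFunction N) {K : Set ℤ}
    (hK : K.OrdConnected) {ι : Type*} [Nonempty ι] {r : ι → ℕ → ℝ}
    (hr : ∀ n, range (fun k => (r k n)⁻¹) = orliczInvRatios N K n) {x y : ℝ} (hy : 0 ≤ y)
    (hlim : Tendsto (fun n : ℕ => 1 / (n : ℝ) * Real.logb 2 (⨆ k, r k n)) atTop (𝓝 (-x))) :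
    y < x ↔ ∃ z, y < z ∧ LowerGrowth (orliczInv N) (zpowHull 2 K) z := by
  have hone : ∀ k n, 1 ≤ (r k n)⁻¹ := fun k n =>
    (orliczInvRatios_subset_Icc hN K n (hr n ▸ mem_range_self k)).1
  have hpos : ∀ k n, 0 < r k n := fun k n => inv_pos.1 (one_pos.trans_le (hone k n))
  constructor
  · intro hxy
    obtain ⟨z, hyz, hzx⟩ := exists_between hxy
    obtain ⟨C, hC, H⟩ := exists_forall_le_mul_pow_of_tendsto_logb_iSup
      (fun n => ⟨1, forall_mem_range.2 fun k => (one_le_inv₀ (hpos k n)).1 (hone k n)⟩)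
      hpos hlim (neg_lt_neg hzx)
    refine ⟨z, hyz, (lowerGrowth_orliczInv_iff hN hK (hy.trans hyz.le)).2
      ⟨C, hC, fun n => ?_⟩⟩
    rw [← hr n, forall_mem_range]
    exact fun k => (inv_inv (r k n)).symm ▸ H k n
  · rintro ⟨z, hyz, h⟩
    obtain ⟨C, hC, H⟩ := (lowerGrowth_orliczInv_iff hN hK (hy.trans hyz.le)).1 h
    have hle : ∀ k n, r k n ≤ C * ((2 : ℝ) ^ (-z)) ^ n := fun k n => by
      have := H n (r k n)⁻¹ (hr n ▸ mem_range_self k)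
      rwa [inv_inv] at this
    linarith [le_of_tendsto_logb_iSup hpos hC hlim hle]

theorem range_ratio_sub (N : ℝ → ℝ) (n : ℕ) :
    range (fun k : ℤ => orliczInv N (2 ^ k) / orliczInv N (2 ^ (k - (n : ℤ)))) =
      orliczInvRatios N univ n := by
  ext ρ
  constructor
  · rintro ⟨k, rfl⟩
    exact ⟨k - n, by simp, by simp⟩
  · rintro ⟨i, -, rfl⟩
    exact ⟨i + n, by simp⟩

theorem range_ratio_sub_nonpos (N : ℝ → ℝ) (n : ℕ) :
    range (fun k : {k : ℤ // k ≤ 0} =>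
      orliczInv N (2 ^ (k : ℤ)) / orliczInv N (2 ^ ((k : ℤ) - (n : ℤ)))) =
      orliczInvRatios N (Iic 0) n := by
  ext ρ
  constructor
  · rintro ⟨⟨k, hk⟩, rfl⟩
    exact ⟨k - n, ⟨mem_Iic.2 (by omega), by simpa using hk⟩, by simp⟩
  · rintro ⟨i, ⟨-, hi⟩, rfl⟩
    exact ⟨⟨i + n, hi⟩, by simp⟩

theorem range_ratio_add_nonneg (N : ℝ → ℝ) (n : ℕ) :
    range (fun k : {k : ℤ // 0 ≤ k} =>
      orliczInv N (2 ^ ((k : ℤ) + (n : ℤ))) / orliczInv N (2 ^ (k : ℤ))) =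
      orliczInvRatios N (Ici 0) n := by
  ext ρ
  constructor
  · rintro ⟨⟨k, hk⟩, rfl⟩
    exact ⟨k, ⟨hk, mem_Ici.2 (by omega)⟩, rfl⟩
  · rintro ⟨i, ⟨hi, -⟩, rfl⟩
    exact ⟨⟨i, hi⟩, rfl⟩

theorem orliczBeta_lt_iff_orliczInv (hN : IsOrliczFunction N) {y : ℝ} (hy : 0 < y) :
    orliczBeta N < y ↔ ∃ z, 0 < z ∧ z < y ∧ UpperGrowth (orliczInv N) (Ioi 0) z := by
  rw [← zpowHull_univ one_lt_two]
  exact lt_iff_exists_upperGrowth_orliczInv hN ordConnected_univ (range_ratio_sub N) hy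
    (tendsto_orliczBeta hN)

theorem orliczBetaZero_lt_iff_orliczInv (hN : IsOrliczFunction N) {y : ℝ} (hy : 0 < y) :
    orliczBetaZero N < y ↔ ∃ z, 0 < z ∧ z < y ∧ UpperGrowth (orliczInv N) (Ici 1) z := by
  have : Nonempty {k : ℤ // 0 ≤ k} := ⟨⟨0, le_rfl⟩⟩
  rw [← zpow_zero (2 : ℝ), ← zpowHull_Ici one_lt_two]
  exact lt_iff_exists_upperGrowth_orliczInv hN ordConnected_Ici (range_ratio_add_nonneg N) hy
    (tendsto_orliczBetaZero hN)

theorem lt_orliczAlpha_iff_orliczInv (hN : IsOrliczFunction N) {y : ℝ} (hy : 0 ≤ y) :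
    y < orliczAlpha N ↔ ∃ z, y < z ∧ LowerGrowth (orliczInv N) (Ioi 0) z := by
  rw [← zpowHull_univ one_lt_two]
  exact lt_neg_iff_exists_lowerGrowth_orliczInv hN ordConnected_univ
    (by simpa only [inv_div] using range_ratio_sub N) hy (tendsto_orliczAlpha hN)

theorem lt_orliczAlphaInfty_iff_orliczInv (hN : IsOrliczFunction N) {y : ℝ} (hy : 0 ≤ y) :
    y < orliczAlphaInfty N ↔ ∃ z, y < z ∧ LowerGrowth (orliczInv N) (Ioc 0 1) z := by
  have : Nonempty {k : ℤ // k ≤ 0} := ⟨⟨0, le_rfl⟩⟩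
  rw [← zpow_zero (2 : ℝ), ← zpowHull_Iic one_lt_two]
  exact lt_neg_iff_exists_lowerGrowth_orliczInv hN ordConnected_Iic
    (by simpa only [inv_div] using range_ratio_sub_nonpos N) hy (tendsto_orliczAlphaInfty hN)

theorem orliczBeta_lt_iff (hN : IsOrliczFunction N) {y : ℝ} (hy : 0 < y) :
    orliczBeta N < y ↔ ∃ q > 0, 1 < y * q ∧ LowerGrowth N (Ioi 0) q := by
  rw [orliczBeta_lt_iff_orliczInv hN hy]
  constructor
  · rintro ⟨z, hz, hzy, h⟩
    refine ⟨z⁻¹, inv_pos.2 hz, (one_lt_div hz).2 hzy, ?_⟩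
    rwa [hN.lowerGrowth_iff subset_rfl (inv_pos.2 hz), hN.image_Ioi, inv_inv]
  · rintro ⟨q, hq, hqy, h⟩
    refine ⟨q⁻¹, inv_pos.2 hq, (inv_lt_iff_one_lt_mul₀ hq).2 hqy, ?_⟩
    rwa [hN.lowerGrowth_iff subset_rfl hq, hN.image_Ioi] at h

theorem orliczBetaZero_lt_iff (hN : IsOrliczFunction N) {y t₀ : ℝ} (hy : 0 < y) (ht₀ : 0 < t₀) :
    orliczBetaZero N < y ↔ ∃ q > 0, 1 < y * q ∧ LowerGrowth N (Ici t₀) q := by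
  rw [orliczBetaZero_lt_iff_orliczInv hN hy]
  constructor
  · rintro ⟨z, hz, hzy, h⟩
    refine ⟨z⁻¹, inv_pos.2 hz, (one_lt_div hz).2 hzy, ?_⟩
    rw [hN.lowerGrowth_iff (Ici_subset_Ioi.2 ht₀) (inv_pos.2 hz), hN.image_Ici ht₀.le, inv_inv]
    exact h.orliczInv_Ici hN one_pos (hN.pos ht₀)
  · rintro ⟨q, hq, hqy, h⟩
    refine ⟨q⁻¹, inv_pos.2 hq, (inv_lt_iff_one_lt_mul₀ hq).2 hqy, ?_⟩
    rw [hN.lowerGrowth_iff (Ici_subset_Ioi.2 ht₀) hq, hN.image_Ici ht₀.le] at h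
    exact h.orliczInv_Ici hN (hN.pos ht₀) one_pos

theorem lt_orliczAlpha_iff (hN : IsOrliczFunction N) {y : ℝ} (hy : 0 ≤ y) :
    y < orliczAlpha N ↔ ∃ q > 0, y * q < 1 ∧ UpperGrowth N (Ioi 0) q := by
  rw [lt_orliczAlpha_iff_orliczInv hN hy]
  constructor
  · rintro ⟨z, hyz, h⟩
    have hz := hy.trans_lt hyz
    refine ⟨z⁻¹, inv_pos.2 hz, (div_lt_one hz).2 hyz, ?_⟩
    rwa [hN.upperGrowth_iff subset_rfl (inv_pos.2 hz), hN.image_Ioi, inv_inv]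
  · rintro ⟨q, hq, hqy, h⟩
    refine ⟨q⁻¹, by rwa [← one_div, lt_div_iff₀ hq], ?_⟩
    rwa [hN.upperGrowth_iff subset_rfl hq, hN.image_Ioi] at h

theorem lt_orliczAlphaInfty_iff (hN : IsOrliczFunction N) {y t₀ : ℝ} (hy : 0 ≤ y)
    (ht₀ : 0 < t₀) :
    y < orliczAlphaInfty N ↔ ∃ q > 0, y * q < 1 ∧ UpperGrowth N (Ioc 0 t₀) q := by
  rw [lt_orliczAlphaInfty_iff_orliczInv hN hy]
  constructor
  · rintro ⟨z, hyz, h⟩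
    have hz := hy.trans_lt hyz
    refine ⟨z⁻¹, inv_pos.2 hz, (div_lt_one hz).2 hyz, ?_⟩
    rw [hN.upperGrowth_iff Ioc_subset_Ioi_self (inv_pos.2 hz), hN.image_Ioc ht₀.le, inv_inv]
    exact h.orliczInv_Ioc hN one_pos (hN.pos ht₀)
  · rintro ⟨q, hq, hqy, h⟩
    refine ⟨q⁻¹, by rwa [← one_div, lt_div_iff₀ hq], ?_⟩
    rw [hN.upperGrowth_iff Ioc_subset_Ioi_self hq, hN.image_Ioc ht₀.le] at h
    exact h.orliczInv_Ioc hN (hN.pos ht₀) one_pos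

theorem ratio_sub_mem_Icc (hN : IsOrliczFunction N) (k : ℤ) (n : ℕ) :
    orliczInv N (2 ^ k) / orliczInv N (2 ^ (k - (n : ℤ))) ∈ Icc 1 (2 ^ n) :=
  orliczInvRatios_subset_Icc hN univ n (range_ratio_sub N n ▸ mem_range_self k)

theorem inv_ratio_sub_mem_Ioc (hN : IsOrliczFunction N) (k : ℤ) (n : ℕ) :
    orliczInv N (2 ^ (k - (n : ℤ))) / orliczInv N (2 ^ k) ∈ Ioc 0 1 := by
  have hone := (ratio_sub_mem_Icc hN k n).1
  rw [← inv_div]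
  exact ⟨inv_pos.2 (one_pos.trans_le hone), inv_le_one_of_one_le₀ hone⟩

theorem orliczBeta_le_one (hN : IsOrliczFunction N) : orliczBeta N ≤ 1 :=
  le_of_tendsto_logb_iSup (fun k n => one_pos.trans_le (ratio_sub_mem_Icc hN k n).1) one_pos
    (tendsto_orliczBeta hN) fun k n => by simpa using (ratio_sub_mem_Icc hN k n).2

theorem orliczAlpha_nonneg (hN : IsOrliczFunction N) : 0 ≤ orliczAlpha N :=
  neg_nonpos.1 <| le_of_tendsto_logb_iSup (fun k n => (inv_ratio_sub_mem_Ioc hN k n).1) one_pos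
    (tendsto_orliczAlpha hN) fun k n => by simpa using (inv_ratio_sub_mem_Ioc hN k n).2

theorem logb_iSup_le_logb_iSup {ι κ : Type*} [Nonempty ι] {r : ι → ℝ} {r' : κ → ℝ}
    (hr : range r ⊆ range r') (hpos : ∀ i, 0 < r i) (hbdd : BddAbove (range r')) :
    Real.logb 2 (⨆ i, r i) ≤ Real.logb 2 (⨆ j, r' j) :=
  Real.logb_le_logb_of_le one_lt_two
    ((hpos (Classical.arbitrary ι)).trans_le (le_ciSup (hbdd.mono hr) _))
    (csSup_le_csSup hbdd (range_nonempty r) hr)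

theorem orliczBetaZero_le_orliczBeta (hN : IsOrliczFunction N) :
    orliczBetaZero N ≤ orliczBeta N := by
  have : Nonempty {k : ℤ // 0 ≤ k} := ⟨⟨0, le_rfl⟩⟩
  refine le_of_tendsto_of_tendsto' (tendsto_orliczBetaZero hN) (tendsto_orliczBeta hN) fun n =>
    mul_le_mul_of_nonneg_left (logb_iSup_le_logb_iSup ?_ ?_ ?_) (by positivity)
  · rw [range_ratio_add_nonneg, range_ratio_sub]
    exact image_mono fun _ _ => ⟨mem_univ _, mem_univ _⟩
  · exact fun k => div_pos (orliczInv_pos hN (by positivity)) (orliczInv_pos hN (by positivity))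
  · exact ⟨2 ^ n, forall_mem_range.2 fun k => (ratio_sub_mem_Icc hN k n).2⟩

theorem orliczAlpha_le_orliczAlphaInfty (hN : IsOrliczFunction N) :
    orliczAlpha N ≤ orliczAlphaInfty N := by
  have : Nonempty {k : ℤ // k ≤ 0} := ⟨⟨0, le_rfl⟩⟩
  refine neg_le_neg_iff.1 (le_of_tendsto_of_tendsto' (tendsto_orliczAlphaInfty hN)
    (tendsto_orliczAlpha hN) fun n =>
    mul_le_mul_of_nonneg_left (logb_iSup_le_logb_iSup ?_ ?_ ?_) (by positivity))
  · exact range_subset_iff.2 fun k => ⟨k, rfl⟩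
  · exact fun k => (inv_ratio_sub_mem_Ioc hN k n).1
  · exact ⟨1, forall_mem_range.2 fun k => (inv_ratio_sub_mem_Ioc hN k n).2⟩

theorem orliczAlpha_le_orliczBetaZero (hN : IsOrliczFunction N) :
    orliczAlpha N ≤ orliczBetaZero N := by
  suffices 0 ≤ orliczBetaZero N + -orliczAlpha N by linarith
  refine ge_of_tendsto' ((tendsto_orliczBetaZero hN).add (tendsto_orliczAlpha hN)) fun n => ?_
  set A := ⨆ k : ℤ, orliczInv N (2 ^ (k - (n : ℤ))) / orliczInv N (2 ^ k)
  set B := ⨆ k : {k : ℤ // 0 ≤ k},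
    orliczInv N (2 ^ ((k : ℤ) + (n : ℤ))) / orliczInv N (2 ^ (k : ℤ))
  have hpos : ∀ k : ℤ, 0 < orliczInv N (2 ^ k) := fun k => orliczInv_pos hN (by positivity)
  have hA : orliczInv N (2 ^ (0 : ℤ)) / orliczInv N (2 ^ (n : ℤ)) ≤ A := by
    simpa only [sub_self] using le_ciSup
      ⟨1, forall_mem_range.2 fun k => (inv_ratio_sub_mem_Ioc hN k n).2⟩ (n : ℤ)
  have hB : orliczInv N (2 ^ (n : ℤ)) / orliczInv N (2 ^ (0 : ℤ)) ≤ B := by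
    have hbdd : BddAbove (range fun k : {k : ℤ // 0 ≤ k} =>
        orliczInv N (2 ^ ((k : ℤ) + (n : ℤ))) / orliczInv N (2 ^ (k : ℤ))) := by
      rw [range_ratio_add_nonneg]
      exact bddAbove_Icc.mono (orliczInvRatios_subset_Icc hN _ n)
    simpa only [zero_add] using le_ciSup hbdd ⟨0, le_rfl⟩
  have hA0 : 0 < A := (div_pos (hpos _) (hpos _)).trans_le hA
  have hB0 : 0 < B := (div_pos (hpos _) (hpos _)).trans_le hB
  rw [← mul_add, ← Real.logb_mul hB0.ne' hA0.ne']
  refine mul_nonneg (by positivity) (Real.logb_nonneg one_lt_two ?_)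
  calc 1 = orliczInv N (2 ^ (n : ℤ)) / orliczInv N (2 ^ (0 : ℤ)) *
        (orliczInv N (2 ^ (0 : ℤ)) / orliczInv N (2 ^ (n : ℤ))) := by
        rw [div_mul_div_cancel₀ (hpos 0).ne', div_self (hpos n).ne']
    _ ≤ B * A := mul_le_mul hB hA (div_pos (hpos _) (hpos _)).le hB0.le

end Indices

section Steepness

/-- `f` escapes the power function `t ^ p` around every point: for all large `l`, at least one of
`f (l * t)` and `f (t / l)` exceeds what the power `p` would predict from `f t`, by any prescribed
factor and uniformly in `t`. -/
def SteepAround (f : ℝ → ℝ) (p : ℝ) : Prop :=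
  ∀ B : ℝ, ∀ᶠ l in atTop, ∀ t > 0, B * f t ≤ l ^ (-p) * f (l * t) + l ^ p * f (t / l)

variable {f N : ℝ → ℝ} {S T : Set ℝ} {p q q' : ℝ}

theorem LowerGrowth.eventually_le (h : LowerGrowth f S q) (hS : S ⊆ Ioi 0) (hSu : IsUpperSet S)
    (hf : ∀ t ∈ S, 0 ≤ f t) (hpq : p < q) (B : ℝ) :
    ∀ᶠ l in atTop, ∀ t ∈ S, B * f t ≤ l ^ (-p) * f (l * t) := by
  obtain ⟨C, hC, hG⟩ := h
  filter_upwards [(tendsto_rpow_atTop (sub_pos.2 hpq)).eventually_ge_atTop (C * B),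
    eventually_ge_atTop 1] with l hl hl1 t ht
  have hl0 : 0 < l := one_pos.trans_le hl1
  have ht0 : 0 < t := hS ht
  have hlt : t ≤ l * t := le_mul_of_one_le_left ht0.le hl1
  have hgrowth := hG t ht (l * t) (hSu hlt ht) hlt
  rw [mul_div_cancel_right₀ _ ht0.ne'] at hgrowth
  refine le_of_mul_le_mul_left (a := C) ?_ hC
  calc C * (B * f t) = C * B * f t := by ring
    _ ≤ l ^ (q - p) * f t := mul_le_mul_of_nonneg_right hl (hf t ht)
    _ = l ^ (-p) * (l ^ q * f t) := by
      rw [← mul_assoc, ← Real.rpow_add hl0, neg_add_eq_sub]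
    _ ≤ l ^ (-p) * (C * f (l * t)) := by gcongr
    _ = C * (l ^ (-p) * f (l * t)) := by ring

theorem UpperGrowth.eventually_le (h : UpperGrowth f T q) (hT : T ⊆ Ioi 0)
    (hTl : ∀ t ∈ T, ∀ s > 0, s ≤ t → s ∈ T) (hf : ∀ t ∈ T, 0 ≤ f t) (hqp : q < p) (B : ℝ) :
    ∀ᶠ l in atTop, ∀ t ∈ T, B * f t ≤ l ^ p * f (t / l) := by
  obtain ⟨C, _, hG⟩ := h
  filter_upwards [(tendsto_rpow_atTop (sub_pos.2 hqp)).eventually_ge_atTop (|B| * C),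
    eventually_ge_atTop 1] with l hl hl1 t ht
  have hl0 : 0 < l := one_pos.trans_le hl1
  have ht0 : 0 < t := hT ht
  have htl : t / l ∈ T := hTl t ht _ (div_pos ht0 hl0) (div_le_self ht0.le hl1)
  have hgrowth := hG (t / l) htl t ht (div_le_self ht0.le hl1)
  rw [div_div_cancel₀ ht0.ne'] at hgrowth
  have hnonneg : 0 ≤ l ^ q * f (t / l) := mul_nonneg (by positivity) (hf _ htl)
  calc B * f t ≤ |B| * f t := mul_le_mul_of_nonneg_right (le_abs_self B) (hf t ht)
    _ ≤ |B| * (C * (l ^ q * f (t / l))) := by gcongr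
    _ = |B| * C * (l ^ q * f (t / l)) := by ring
    _ ≤ l ^ (p - q) * (l ^ q * f (t / l)) := by gcongr
    _ = l ^ p * f (t / l) := by rw [← mul_assoc, ← Real.rpow_add hl0, sub_add_cancel]

theorem steepAround_of_lowerGrowth_of_upperGrowth (hlow : LowerGrowth f S q)
    (hup : UpperGrowth f T q') (hpq : p < q) (hqp : q' < p) (hST : S ∪ T = Ioi 0)
    (hSu : IsUpperSet S) (hTl : ∀ t ∈ T, ∀ s > 0, s ≤ t → s ∈ T) (hf : ∀ t > 0, 0 ≤ f t) :
    SteepAround f p := by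
  intro B
  have hS : S ⊆ Ioi 0 := hST ▸ subset_union_left
  have hT : T ⊆ Ioi 0 := hST ▸ subset_union_right
  filter_upwards [hlow.eventually_le hS hSu (fun t ht => hf t (hS ht)) hpq B,
    hup.eventually_le hT hTl (fun t ht => hf t (hT ht)) hqp B,
    eventually_gt_atTop 0] with l hlS hlT hl t ht
  have hleft : 0 ≤ l ^ (-p) * f (l * t) := mul_nonneg (by positivity) (hf _ (mul_pos hl ht))
  have hright : 0 ≤ l ^ p * f (t / l) := mul_nonneg (by positivity) (hf _ (div_pos ht hl))
  rcases hST.symm.subset ht with h | h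
  · exact (hlS t h).trans (le_add_of_nonneg_right hright)
  · exact (hlT t h).trans (le_add_of_nonneg_left hleft)

theorem steepAround_of_orliczBeta_lt (hN : IsOrliczFunction N) (hp : 0 < p)
    (h : orliczBeta N < p⁻¹) : SteepAround N p := by
  obtain ⟨q, -, hpq, hG⟩ := (orliczBeta_lt_iff hN (inv_pos.2 hp)).1 h
  rw [← div_eq_inv_mul, one_lt_div hp] at hpq
  exact steepAround_of_lowerGrowth_of_upperGrowth (T := ∅) (q' := p - 1) hG ⟨1, one_pos, by simp⟩
    hpq (sub_one_lt p) (union_empty _) (isUpperSet_Ioi 0) (by simp) fun t ht => (hN.pos ht).le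

theorem steepAround_of_lt_orliczAlpha (hN : IsOrliczFunction N) (hp : 0 < p)
    (h : p⁻¹ < orliczAlpha N) : SteepAround N p := by
  obtain ⟨q, -, hqp, hG⟩ := (lt_orliczAlpha_iff hN (inv_pos.2 hp).le).1 h
  rw [← div_eq_inv_mul, div_lt_one hp] at hqp
  exact steepAround_of_lowerGrowth_of_upperGrowth (S := ∅) (q := p + 1) ⟨1, one_pos, by simp⟩ hG
    (lt_add_one p) hqp (empty_union _) isUpperSet_empty (fun _ _ _ hs _ => hs)
    fun t ht => (hN.pos ht).le

theorem steepAround_of_orliczBetaZero_lt_of_lt_orliczAlphaInfty (hN : IsOrliczFunction N)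
    (hp : 0 < p) (hβ : orliczBetaZero N < p⁻¹) (hα : p⁻¹ < orliczAlphaInfty N) :
    SteepAround N p := by
  obtain ⟨q, -, hpq, hlow⟩ := (orliczBetaZero_lt_iff hN (inv_pos.2 hp) one_pos).1 hβ
  obtain ⟨q', -, hqp, hup⟩ := (lt_orliczAlphaInfty_iff hN (inv_pos.2 hp).le one_pos).1 hα
  rw [← div_eq_inv_mul, one_lt_div hp] at hpq
  rw [← div_eq_inv_mul, div_lt_one hp] at hqp
  exact steepAround_of_lowerGrowth_of_upperGrowth hlow hup hpq hqp
    (by rw [union_comm, Ioc_union_Ici_eq_Ioi one_pos]) (isUpperSet_Ici 1)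
    (fun _ ht _ hs hst => ⟨hs, hst.trans ht.2⟩) fun t ht => (hN.pos ht).le

end Steepness

section Modular

/-- The modular `∫₀^∞ N (s |x(t)|) dt` of `s • x`, as a function of the scale `s`. -/
noncomputable def orliczModular (N x : ℝ → ℝ) (s : ℝ) : ℝ≥0∞ :=
  ∫⁻ t, ENNReal.ofReal (N (s * |x t|)) ∂halfLine

variable {N x y : ℝ → ℝ} {s t u : ℝ}

theorem mem_luxemburgSet_iff : u ∈ luxemburgSet N x ↔ 0 < u ∧ orliczModular N x u⁻¹ ≤ 1 := by
  simp only [luxemburgSet, mem_ofPred_eq, div_eq_inv_mul, orliczModular]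

theorem orliczModular_mono (hN : IsOrliczFunction N) (hs : 0 ≤ s) (hst : s ≤ t) :
    orliczModular N x s ≤ orliczModular N x t :=
  lintegral_mono fun _ => ENNReal.ofReal_le_ofReal <|
    hN.mono (by positivity) (by gcongr)

theorem IsOrliczFunction.aemeasurable_comp (hN : IsOrliczFunction N) (hx : AEMeasurable x halfLine)
    (hs : 0 ≤ s) : AEMeasurable (fun t => N (s * |x t|)) halfLine := by
  have hcont : Continuous fun t => N (s * |t|) :=
    hN.continuous.comp_continuous (by fun_prop) fun t => mul_nonneg hs (abs_nonneg t)
  exact hcont.measurable.comp_aemeasurable hx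

theorem ofReal_orlicz_abs_sum {ι : Type*} [Fintype ι] (hN : IsOrliczFunction N) {v : ι → ℝ}
    (hv : ∀ i j, i ≠ j → v i = 0 ∨ v j = 0) (a : ι → ℝ) (s : ℝ) :
    ENNReal.ofReal (N (s * |∑ k, a k * v k|)) =
      ∑ k, ENNReal.ofReal (N (s * |a k| * |v k|)) := by
  by_cases h : ∃ i, v i ≠ 0
  · obtain ⟨i, hi⟩ := h
    have h0 : ∀ j, j ≠ i → v j = 0 := fun j hj => (hv i j hj.symm).resolve_left hi
    rw [Finset.sum_eq_single i (fun j _ hj => by rw [h0 j hj, mul_zero]) (by simp),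
      Finset.sum_eq_single i (fun j _ hj => by simp [h0 j hj, hN.map_zero]) (by simp), abs_mul,
      mul_assoc]
  · push Not at h
    simp [h, hN.map_zero]

theorem orliczModular_sum {ι : Type*} [Fintype ι] (hN : IsOrliczFunction N) {x : ι → ℝ → ℝ}
    (hx : ∀ i, AEMeasurable (x i) halfLine)
    (hd : ∀ i j, i ≠ j → DisjointSupports (x i) (x j)) (a : ι → ℝ) (hs : 0 ≤ s) :
    orliczModular N (fun t => ∑ k, a k * x k t) s = ∑ k, orliczModular N (x k) (s * |a k|) := by
  have hdisj : ∀ᵐ t ∂halfLine, ∀ i j, i ≠ j → x i t = 0 ∨ x j t = 0 := by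
    simp only [ae_all_iff]
    exact hd
  simp only [orliczModular]
  rw [← lintegral_finsetSum' _ fun k _ =>
    (hN.aemeasurable_comp (hx k) (mul_nonneg hs (abs_nonneg _))).ennreal_ofReal]
  exact lintegral_congr_ae (hdisj.mono fun t ht => ofReal_orlicz_abs_sum hN ht a s)

theorem Equimeasurable.orliczModular_eq (h : Equimeasurable x y) (hN : IsOrliczFunction N)
    (hx : AEMeasurable x halfLine) (hy : AEMeasurable y halfLine) (hs : 0 ≤ s) :
    orliczModular N x s = orliczModular N y s := by
  rcases hs.eq_or_lt with rfl | hs0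
  · simp [orliczModular]
  have hnonneg : ∀ z : ℝ → ℝ, 0 ≤ᵐ[halfLine] fun t => N (s * |z t|) := fun z =>
    ae_of_all _ fun t => hN.nonneg (by positivity)
  have hlevel : ∀ z : ℝ → ℝ, ∀ v > 0,
      {t | v < N (s * |z t|)} = {t | orliczInv N v / s < |z t|} := by
    intro z v hv
    have hinv := orliczInv_spec hN hv.le
    ext t
    simp only [mem_ofPred_eq]
    rw [div_lt_iff₀' hs0, ← hN.increasing.lt_iff_lt (mem_Ici.2 hinv.1)
      (mem_Ici.2 (by positivity)), hinv.2]
  rw [orliczModular, orliczModular,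
    lintegral_eq_lintegral_meas_lt _ (hnonneg x) (hN.aemeasurable_comp hx hs),
    lintegral_eq_lintegral_meas_lt _ (hnonneg y) (hN.aemeasurable_comp hy hs)]
  refine setLIntegral_congr_fun measurableSet_Ioi fun v hv => ?_
  simp only [hlevel _ v hv]
  exact h _ (div_pos (orliczInv_pos hN hv) hs0)

theorem orliczModular_le_one_of_orliczNorm_lt (hN : IsOrliczFunction N) (hs : 0 < s)
    (h0 : 0 < orliczNorm N x) (h : orliczNorm N x < s⁻¹) : orliczModular N x s ≤ 1 := by
  have hne : (luxemburgSet N x).Nonempty := by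
    by_contra hempty
    rw [orliczNorm, not_nonempty_iff_eq_empty.1 hempty, Real.sInf_empty] at h0
    exact lt_irrefl 0 h0
  obtain ⟨v, hv, hvs⟩ := exists_lt_of_csInf_lt hne h
  obtain ⟨hv0, hv1⟩ := mem_luxemburgSet_iff.1 hv
  exact (orliczModular_mono hN hs.le ((lt_inv_comm₀ hv0 hs).1 hvs).le).trans hv1

theorem orliczNorm_le (hu : 0 < u) (h : orliczModular N x u⁻¹ ≤ 1) : orliczNorm N x ≤ u :=
  csInf_le ⟨0, fun _ hv => hv.1.le⟩ (mem_luxemburgSet_iff.2 ⟨hu, h⟩)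

theorem one_lt_orliczModular_of_lt_orliczNorm (hs : 0 < s) (h : s⁻¹ < orliczNorm N x) :
    1 < orliczModular N x s := by
  by_contra! hle
  rw [← inv_inv s] at hle
  exact h.not_ge (orliczNorm_le (inv_pos.2 hs) hle)

end Modular

section Necessity

variable {N : ℝ → ℝ} {p : ℝ≥0∞}

theorem norm_toLp_indicator_one {ι : Type*} [Fintype ι] (hp : p ≠ 0) {A : Finset ι}
    (hA : A.Nonempty) :
    ‖WithLp.toLp p ((A : Set ι).indicator (1 : ι → ℝ))‖ = (A.card : ℝ) ^ p.toReal⁻¹ := by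
  have hval : ∀ i, ‖(A : Set ι).indicator (1 : ι → ℝ) i‖ = (A : Set ι).indicator 1 i :=
    fun i => by by_cases hi : i ∈ A <;> simp [hi]
  rcases eq_or_ne p ∞ with rfl | hp'
  · obtain ⟨i, hi⟩ := hA
    have : Nonempty ι := ⟨i⟩
    rw [PiLp.norm_eq_ciSup, ENNReal.toReal_top, inv_zero, Real.rpow_zero]
    simp only [hval]
    refine le_antisymm (ciSup_le fun j => indicator_le_self' (fun _ _ => zero_le_one) j) ?_
    exact (by simp [hi] : (1 : ℝ) = (A : Set ι).indicator 1 i).le.trans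
      (le_ciSup (finite_range _).bddAbove i)
  · have hpos : 0 < p.toReal := ENNReal.toReal_pos hp hp'
    have hpow : ∀ i, (A : Set ι).indicator (1 : ι → ℝ) i ^ p.toReal = (A : Set ι).indicator 1 i :=
      fun i => by by_cases hi : i ∈ A <;> simp [hi, hpos.ne']
    rw [PiLp.norm_eq_sum hpos, one_div]
    simp only [hval, hpow]
    rw [Finset.sum_indicator_subset _ (Finset.subset_univ A)]
    simp

theorem SymmFinitelyRepresented.exists_orliczModular (h : SymmFinitelyRepresented N p)
    (hN : IsOrliczFunction N) (hp : p ≠ 0) {n : ℕ} (hn : 0 < n) :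
    ∃ x : ℝ → ℝ, AEMeasurable x halfLine ∧ ∀ m : ℕ, 0 < m → m ≤ n → ∀ s : ℝ, 0 < s →
      (2 * s * (m : ℝ) ^ p.toReal⁻¹ < 1 → m * orliczModular N x s ≤ 1) ∧
      (2 < s * (m : ℝ) ^ p.toReal⁻¹ → 1 < m * orliczModular N x s) := by
  obtain ⟨x, hmem, heq, hd, hnorm⟩ := h n 1 one_pos
  have hx := fun i => (hmem i).1
  refine ⟨x ⟨0, hn⟩, hx _, fun m hm hmn s hs => ?_⟩
  obtain ⟨A, -, rfl⟩ := Finset.exists_subset_card_eq (s := (Finset.univ : Finset (Fin n)))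
    (by simpa using hmn)
  set a : Fin n → ℝ := (A : Set (Fin n)).indicator 1 with ha
  set S : ℝ → ℝ := fun t => ∑ k, a k * x k t with hS
  have hmodular : orliczModular N S s = A.card * orliczModular N (x ⟨0, hn⟩) s := by
    have hterm : ∀ k, orliczModular N (x k) (s * |a k|) =
        (A : Set (Fin n)).indicator (fun _ => orliczModular N (x ⟨0, hn⟩) s) k := by
      intro k
      by_cases hk : k ∈ A
      · simp [ha, hk, (heq k ⟨0, hn⟩).orliczModular_eq hN (hx _) (hx _) hs.le]
      · simp [ha, hk, orliczModular, hN.map_zero]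
    rw [hS, orliczModular_sum hN hx hd a hs.le, Finset.sum_congr rfl fun k _ => hterm k,
      Finset.sum_indicator_subset _ (Finset.subset_univ A), Finset.sum_const, nsmul_eq_mul]
  have hkey := hnorm a
  rw [ha, norm_toLp_indicator_one hp (Finset.card_pos.1 hm), ← ha, one_add_one_eq_two] at hkey
  set ν := (A.card : ℝ) ^ p.toReal⁻¹
  have hν : 0 < ν := Real.rpow_pos_of_pos (Nat.cast_pos.2 hm) _
  rw [← hmodular]
  constructor <;> intro hlt
  · refine orliczModular_le_one_of_orliczNorm_lt hN hs (lt_of_lt_of_le (by positivity) hkey.1)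
      (hkey.2.trans_lt ?_)
    rw [← one_div, lt_div_iff₀ hs]
    linarith
  · refine one_lt_orliczModular_of_lt_orliczNorm hs (lt_of_lt_of_le ?_ hkey.1)
    rw [inv_lt_iff_one_lt_mul₀ hs]
    linarith

theorem ofReal_inv_le_of_forall_one_lt_natCast_mul {y : ℝ} {φ : ℝ≥0∞} (hy : 1 ≤ y)
    (h : ∀ m : ℕ, y < m → m ≤ y + 1 → 1 < m * φ) : ENNReal.ofReal (2 * y)⁻¹ ≤ φ := by
  have hfloor := Nat.floor_le (zero_le_one.trans hy)
  have hmul := h (⌊y⌋₊ + 1) (by exact_mod_cast Nat.lt_floor_add_one y) (by push_cast; linarith)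
  rw [ENNReal.ofReal_inv_of_pos (by positivity), ENNReal.inv_le_iff_inv_le]
  calc φ⁻¹ ≤ ((⌊y⌋₊ + 1 : ℕ) : ℝ≥0∞) :=
        (ENNReal.inv_le_iff_le_mul (by simp) (by simp)).2 (mul_comm φ _ ▸ hmul.le)
    _ = ENNReal.ofReal (⌊y⌋₊ + 1 : ℕ) := (ENNReal.ofReal_natCast _).symm
    _ ≤ ENNReal.ofReal (2 * y) := ENNReal.ofReal_le_ofReal (by push_cast; linarith)

theorem le_ofReal_inv_of_forall_natCast_mul_le_one {y : ℝ} {φ : ℝ≥0∞} (hy : 1 ≤ y)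
    (h : ∀ m : ℕ, 0 < m → m ≤ y → m * φ ≤ 1) : φ ≤ ENNReal.ofReal (y / 2)⁻¹ := by
  have hpos : 0 < ⌊y⌋₊ := Nat.floor_pos.2 hy
  have hmul := h ⌊y⌋₊ hpos (Nat.floor_le (zero_le_one.trans hy))
  have hhalf : y / 2 ≤ ⌊y⌋₊ := by
    have hone : (1 : ℝ) ≤ ⌊y⌋₊ := Nat.one_le_cast.2 hpos
    linarith [Nat.lt_floor_add_one y]
  rw [mul_comm, ← ENNReal.le_inv_iff_mul_le, ← ENNReal.ofReal_natCast,
    ← ENNReal.ofReal_inv_of_pos (Nat.cast_pos.2 hpos)] at hmul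
  exact hmul.trans (ENNReal.ofReal_le_ofReal (by gcongr))

theorem SymmFinitelyRepresented.exists_orliczModular_bounds (h : SymmFinitelyRepresented N p)
    (hN : IsOrliczFunction N) (hp : 0 < p.toReal) {s₀ : ℝ} (hs₀ : 0 < s₀) :
    ∃ x : ℝ → ℝ, AEMeasurable x halfLine ∧ ∀ s, s₀ ≤ s → s ≤ 1 / 4 →
      ENNReal.ofReal (2 * (2 / s) ^ p.toReal)⁻¹ ≤ orliczModular N x s ∧
      orliczModular N x s ≤ ENNReal.ofReal ((4 * s)⁻¹ ^ p.toReal / 2)⁻¹ := by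
  obtain ⟨x, hx, hmod⟩ := h.exists_orliczModular hN (fun h0 => by simp [h0] at hp)
    (Nat.floor_pos.2 (le_add_of_nonneg_left (by positivity) : 1 ≤ (2 / s₀) ^ p.toReal + 1))
  refine ⟨x, hx, fun s hs hs4 => ?_⟩
  have hs0 : 0 < s := hs₀.trans_le hs
  have hmono : (2 / s) ^ p.toReal ≤ (2 / s₀) ^ p.toReal := by gcongr
  constructor
  · refine ofReal_inv_le_of_forall_one_lt_natCast_mul
      (Real.one_le_rpow ((one_le_div hs0).2 (by linarith)) hp.le) fun m hlt hle => ?_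
    have hm : (0 : ℝ) < m := hlt.trans' (by positivity)
    refine (hmod m (Nat.cast_pos.1 hm) (Nat.le_floor (by linarith)) s hs0).2 ?_
    rwa [← div_lt_iff₀' hs0, Real.lt_rpow_inv_iff_of_pos (by positivity) hm.le hp]
  · refine le_ofReal_inv_of_forall_natCast_mul_le_one
      (Real.one_le_rpow ((one_le_inv₀ (by positivity)).2 (by linarith)) hp.le) fun m hm hle => ?_
    have hquarter : (4 * s)⁻¹ ^ p.toReal ≤ (2 / s) ^ p.toReal := by
      refine Real.rpow_le_rpow (by positivity) ?_ hp.le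
      rw [← one_div, div_le_div_iff₀ (by positivity) hs0]
      linarith
    refine (hmod m hm (Nat.le_floor (by linarith)) s hs0).1 ?_
    have hroot := (Real.rpow_inv_le_iff_of_pos m.cast_nonneg (by positivity) hp).2 hle
    calc 2 * s * (m : ℝ) ^ p.toReal⁻¹ ≤ 2 * s * (4 * s)⁻¹ := by gcongr
      _ = 1 / 2 := by field_simp; norm_num
      _ < 1 := by norm_num

theorem SteepAround.eventually_orliczModular_le {P : ℝ} (h : SteepAround N P)
    (hN : IsOrliczFunction N) {B : ℝ} (hB : 0 ≤ B) :
    ∀ᶠ l in atTop, ∀ x : ℝ → ℝ, AEMeasurable x halfLine → ∀ s > 0,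
      ENNReal.ofReal B * orliczModular N x s ≤
        ENNReal.ofReal (l ^ (-P)) * orliczModular N x (l * s) +
          ENNReal.ofReal (l ^ P) * orliczModular N x (s / l) := by
  filter_upwards [h B, eventually_gt_atTop 0] with l hsteep hl x hx s hs
  have hmeas : ∀ r ≥ 0, AEMeasurable (fun t => ENNReal.ofReal (N (r * |x t|))) halfLine :=
    fun r hr => (hN.aemeasurable_comp hx hr).ennreal_ofReal
  have hls := hmeas (l * s) (by positivity)
  have hsl := hmeas (s / l) (by positivity)
  simp only [orliczModular]
  rw [← lintegral_const_mul'' _ (hmeas s hs.le), ← lintegral_const_mul'' _ hls,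
    ← lintegral_const_mul'' _ hsl, ← lintegral_add_left' (hls.const_mul _)]
  refine lintegral_mono fun t => ?_
  have h1 := hN.nonneg (t := l * s * |x t|) (by positivity)
  have h2 := hN.nonneg (t := s / l * |x t|) (by positivity)
  rw [← ENNReal.ofReal_mul hB, ← ENNReal.ofReal_mul (by positivity),
    ← ENNReal.ofReal_mul (by positivity), ← ENNReal.ofReal_add (by positivity) (by positivity)]
  refine ENNReal.ofReal_le_ofReal ?_
  rcases (abs_nonneg (x t)).eq_or_lt with h0 | h0
  · simp [← h0, hN.map_zero]
  · simpa only [mul_assoc, div_mul_eq_mul_div] using hsteep (s * |x t|) (by positivity)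

theorem SteepAround.not_symmFinitelyRepresented (h : SteepAround N p.toReal)
    (hN : IsOrliczFunction N) (hp : 0 < p.toReal) : ¬ SymmFinitelyRepresented N p := by
  intro hF
  obtain ⟨l, hsteep, hl⟩ := ((h.eventually_orliczModular_le hN
    (B := 9 * 8 ^ p.toReal) (by positivity)).and (eventually_gt_atTop 1)).exists
  have hl0 : 0 < l := one_pos.trans hl
  obtain ⟨x, hx, hbounds⟩ := hF.exists_orliczModular_bounds hN hp
    (s₀ := 1 / (4 * l) / l) (by positivity)
  have hmid : 1 / (4 * l) ≤ 1 / 4 := by gcongr; linarith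
  have hlow : 1 / (4 * l) / l ≤ 1 / (4 * l) := div_le_self (by positivity) hl.le
  have hone : l * (1 / (4 * l)) = 1 / 4 := by field_simp
  have hS := hsteep x hx (1 / (4 * l)) (by positivity)
  rw [hone] at hS
  have hchain := ((mul_le_mul_right (hbounds _ hlow hmid).1 _).trans hS).trans
    (add_le_add (mul_le_mul_right (hbounds _ (hlow.trans hmid) le_rfl).2 _)
      (mul_le_mul_right (hbounds _ le_rfl (hlow.trans hmid)).2 _))
  rw [← ENNReal.ofReal_mul (by positivity), ← ENNReal.ofReal_mul (by positivity),
    ← ENNReal.ofReal_mul (by positivity), ← ENNReal.ofReal_add (by positivity) (by positivity),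
    ENNReal.ofReal_le_ofReal_iff (by positivity)] at hchain
  have hlow' : 2 / (1 / (4 * l)) = 8 * l := by field_simp; norm_num
  have hupp' : (4 * (1 / (4 * l) / l))⁻¹ = l * l := by field_simp
  have hone' : (4 * (1 / 4) : ℝ)⁻¹ = 1 := by norm_num
  rw [hlow', hupp', hone', Real.one_rpow, Real.mul_rpow (by norm_num) hl0.le,
    Real.mul_rpow hl0.le hl0.le, Real.rpow_neg hl0.le] at hchain
  have hlp : 0 < l ^ p.toReal := by positivity
  have : 9 / 2 * (l ^ p.toReal)⁻¹ ≤ 4 * (l ^ p.toReal)⁻¹ := by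
    field_simp at hchain ⊢
    linarith
  linarith [inv_pos.2 hlp]

theorem UpperGrowth.not_symmFinitelyRepresented_top {q : ℝ} (h : UpperGrowth N (Ioi 0) q)
    (hN : IsOrliczFunction N) : ¬ SymmFinitelyRepresented N ∞ := by
  intro hF
  obtain ⟨C, hC, hG⟩ := h
  obtain ⟨n, hn⟩ := exists_nat_gt (C * 12 ^ q)
  have hn0 : 0 < n := Nat.cast_pos.1 ((by positivity : (0 : ℝ) < C * 12 ^ q).trans hn)
  obtain ⟨x, -, hmod⟩ := hF.exists_orliczModular hN ENNReal.top_ne_zero hn0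
  have hbig : 1 < orliczModular N x 3 := by
    simpa using (hmod 1 one_pos hn0 3 (by norm_num)).2 (by norm_num)
  have hsmall : n * orliczModular N x (1 / 4) ≤ 1 :=
    (hmod n hn0 le_rfl (1 / 4) (by norm_num)).1 (by norm_num)
  have hcompare :
      orliczModular N x 3 ≤ ENNReal.ofReal (C * 12 ^ q) * orliczModular N x (1 / 4) := by
    rw [orliczModular, orliczModular, ← lintegral_const_mul' _ _ ENNReal.ofReal_ne_top]
    refine lintegral_mono fun t => ?_
    rw [← ENNReal.ofReal_mul (by positivity)]
    refine ENNReal.ofReal_le_ofReal ?_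
    rcases (abs_nonneg (x t)).eq_or_lt with h0 | h0
    · simp [← h0, hN.map_zero]
    · have hgrowth := hG (1 / 4 * |x t|) (mem_Ioi.2 (by positivity)) (3 * |x t|)
        (mem_Ioi.2 (by positivity)) (by linarith)
      rw [mul_div_mul_right _ _ h0.ne', ← mul_assoc] at hgrowth
      norm_num at hgrowth ⊢
      exact hgrowth
  refine (hbig.trans_le (hcompare.trans ?_)).not_ge hsmall
  rw [← ENNReal.ofReal_natCast]
  gcongr

end Necessity

section Translates

variable {N f : ℝ → ℝ} {b s : ℝ}

theorem equimeasurable_comp_sub_right {c : ℝ} (hf : f.support ⊆ Ioi 0) (hc : 0 ≤ c) :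
    Equimeasurable (fun t => f (t - c)) f := by
  intro τ hτ
  have hlevel : {t | τ < |f t|} ⊆ Ioi 0 := fun t ht =>
    hf (abs_pos.1 (hτ.trans ht))
  have hlevel_sub : {t | τ < |f (t - c)|} ⊆ Ioi 0 := fun t ht =>
    hc.trans_lt (sub_pos.1 (hlevel (a := t - c) ht))
  rw [halfLine, Measure.restrict_eq_self _ hlevel, Measure.restrict_eq_self _ hlevel_sub]
  exact measure_preimage_add_right volume (-c) {t | τ < |f t|}

theorem disjointSupports_comp_sub_natCast_mul (hf : f.support ⊆ Ioc 0 b) {i j : ℕ} (hij : i ≠ j) :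
    DisjointSupports (fun t => f (t - i * b)) (fun t => f (t - j * b)) := by
  wlog h : i < j generalizing i j
  · exact (this hij.symm (hij.symm.lt_of_le (not_lt.1 h))).mono fun _ => Or.symm
  refine ae_of_all _ fun t => ?_
  by_contra! hne
  have hi := hf hne.1
  have hj := hf hne.2
  have hle : (i + 1 : ℝ) ≤ j := by exact_mod_cast h
  have := mul_le_mul_of_nonneg_right hle (hi.1.le.trans hi.2)
  linarith [hi.2, hj.1]

theorem orliczModular_sum_translates (hN : IsOrliczFunction N) (hfm : Measurable f) (hb : 0 ≤ b)
    (hf : f.support ⊆ Ioc 0 b) {n : ℕ} (a : Fin n → ℝ) (hs : 0 ≤ s) :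
    orliczModular N (fun t => ∑ k : Fin n, a k * f (t - k * b)) s =
      ∑ k, orliczModular N f (s * |a k|) := by
  have hm : ∀ c : ℝ, AEMeasurable (fun t => f (t - c)) halfLine := fun c =>
    (hfm.comp (measurable_id.sub_const c)).aemeasurable
  rw [orliczModular_sum hN (fun k => hm _)
    (fun i j hij => disjointSupports_comp_sub_natCast_mul hf (Fin.val_ne_of_ne hij)) a hs]
  exact Finset.sum_congr rfl fun k _ =>
    (equimeasurable_comp_sub_right (hf.trans Ioc_subset_Ioi_self) (by positivity)).orliczModular_eq
      hN (hm _) hfm.aemeasurable (by positivity)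

theorem inv_le_orliczNorm (hN : IsOrliczFunction N) (hs : 0 < s)
    (hf : (luxemburgSet N f).Nonempty) (h : 1 < orliczModular N f s) : s⁻¹ ≤ orliczNorm N f := by
  refine le_csInf hf fun u hu => ?_
  obtain ⟨hu0, hu1⟩ := mem_luxemburgSet_iff.1 hu
  by_contra! hlt
  have hle := orliczModular_mono (x := f) hN hs.le ((lt_inv_comm₀ hu0 hs).1 hlt).le
  exact (h.trans_le hle).not_ge hu1

theorem orliczNorm_zero (hN : IsOrliczFunction N) : orliczNorm N (fun _ => 0) = 0 := by
  have : luxemburgSet N (fun _ => 0) = Ioi 0 := by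
    ext u
    simp [luxemburgSet, hN.map_zero]
  rw [orliczNorm, this, csInf_Ioi]

theorem orliczNorm_sum_translates_bounds {p : ℝ≥0∞} [Fact (1 ≤ p)] (hN : IsOrliczFunction N)
    (hfm : Measurable f) (hb : 0 ≤ b) (hf : f.support ⊆ Ioc 0 b) {n : ℕ} {c : ℝ} (hc : 0 < c)
    (h : ∀ a : Fin n → ℝ, ‖WithLp.toLp p a‖ = 1 →
      ∑ k, orliczModular N f (c⁻¹ * |a k|) ≤ 1 ∧ 1 < ∑ k, orliczModular N f (c * |a k|))
    (a : Fin n → ℝ) :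
    c⁻¹ * ‖WithLp.toLp p a‖ ≤ orliczNorm N (fun t => ∑ k : Fin n, a k * f (t - k * b)) ∧
      orliczNorm N (fun t => ∑ k : Fin n, a k * f (t - k * b)) ≤ c * ‖WithLp.toLp p a‖ := by
  rcases eq_or_ne a 0 with rfl | ha
  · simp [orliczNorm_zero hN]
  have hν : 0 < ‖WithLp.toLp p a‖ := norm_pos_iff.2 (by simpa using ha)
  set ν := ‖WithLp.toLp p a‖
  have hnorm : ‖WithLp.toLp p (ν⁻¹ • a)‖ = 1 := by
    rw [WithLp.toLp_smul, norm_smul, Real.norm_of_nonneg (by positivity), inv_mul_cancel₀ hν.ne']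
  have hscale : ∀ d > 0, orliczModular N (fun t => ∑ k : Fin n, a k * f (t - k * b)) (d * ν⁻¹) =
      ∑ k, orliczModular N f (d * |(ν⁻¹ • a) k|) := fun d hd => by
    simp only [orliczModular_sum_translates hN hfm hb hf a (s := d * ν⁻¹) (by positivity),
      Pi.smul_apply, smul_eq_mul, abs_mul, abs_of_pos (inv_pos.2 hν), mul_assoc]
  obtain ⟨hle, hlt⟩ := h _ hnorm
  rw [← hscale _ (by positivity)] at hle hlt
  rw [← mul_inv] at hle
  have hmem := mem_luxemburgSet_iff.2 ⟨by positivity, hle⟩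
  refine ⟨?_, orliczNorm_le (by positivity) hle⟩
  have hge := inv_le_orliczNorm hN (by positivity) ⟨_, hmem⟩ hlt
  rwa [mul_inv, inv_inv] at hge

theorem symmFinitelyRepresented_of_translates {p : ℝ≥0∞} [Fact (1 ≤ p)] (hN : IsOrliczFunction N)
    (h : ∀ (n : ℕ) (ε : ℝ), 0 < ε → ∃ (f : ℝ → ℝ) (b : ℝ), Measurable f ∧ 0 ≤ b ∧
      f.support ⊆ Ioc 0 b ∧ ∀ a : Fin n → ℝ, ‖WithLp.toLp p a‖ = 1 →
        ∑ k, orliczModular N f ((1 + ε)⁻¹ * |a k|) ≤ 1 ∧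
        1 < ∑ k, orliczModular N f ((1 + ε) * |a k|)) :
    SymmFinitelyRepresented N p := by
  intro n ε hε
  obtain ⟨f, b, hfm, hb, hf, hmod⟩ := h n ε hε
  have hequi : ∀ i : Fin n, Equimeasurable (fun t => f (t - i * b)) f := fun i =>
    equimeasurable_comp_sub_right (hf.trans Ioc_subset_Ioi_self) (by positivity)
  have hmeas : ∀ i : Fin n, AEMeasurable (fun t => f (t - i * b)) halfLine := fun i =>
    (hfm.comp (measurable_id.sub_const _)).aemeasurable
  refine ⟨fun i t => f (t - i * b), fun i => ⟨hmeas i, 1 + ε, ?_⟩,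
    fun i j τ hτ => (hequi i τ hτ).trans (hequi j τ hτ).symm,
    fun i j hij => disjointSupports_comp_sub_natCast_mul hf (Fin.val_ne_of_ne hij),
    orliczNorm_sum_translates_bounds hN hfm hb hf (by positivity) hmod⟩
  refine mem_luxemburgSet_iff.2 ⟨by positivity, ?_⟩
  rw [(hequi i).orliczModular_eq hN (hmeas i) hfm.aemeasurable (by positivity)]
  set e : Fin n → ℝ := Pi.single i 1
  have hnorm : ‖WithLp.toLp p e‖ = 1 := by simp [e]
  calc orliczModular N f (1 + ε)⁻¹ = orliczModular N f ((1 + ε)⁻¹ * |e i|) := by simp [e]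
    _ ≤ ∑ k, orliczModular N f ((1 + ε)⁻¹ * |e k|) :=
      Finset.single_le_sum (f := fun k => orliczModular N f ((1 + ε)⁻¹ * |e k|))
        (fun _ _ => zero_le) (Finset.mem_univ i)
    _ ≤ 1 := (hmod _ hnorm).1

end Translates

section BroadWindows

/-- The integral `∫_A^B N (r^{-1/p}) dr`. The profile `r ↦ r^{-1/p}` is the one for which dilating
the argument by `s^{-p}` multiplies the value by `s`, as the modular of an `ℓ^p` basis must. -/
noncomputable def powerIntegral (N : ℝ → ℝ) (p A B : ℝ) : ℝ :=
  ∫ r in A..B, N (r ^ (-p⁻¹))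

/-- There are windows `[A, B]` on which `powerIntegral N p` is arbitrarily large compared to its
values on the windows `[A, L A]` and `[B, L B]` at the two ends. -/
def HasBroadWindows (N : ℝ → ℝ) (p : ℝ) : Prop :=
  ∀ L ε : ℝ, 1 < L → 0 < ε → ∃ A B : ℝ, 0 < A ∧ A < B ∧
    powerIntegral N p A (L * A) + powerIntegral N p B (L * B) ≤ ε * powerIntegral N p A B

/-- The profile `r ↦ r^{-1/p}` cut off to the window `(A, B]`, with the argument rescaled so that
its modular is `1`. -/
noncomputable def powerBump (N : ℝ → ℝ) (p A B : ℝ) : ℝ → ℝ :=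
  (Ioc (A / powerIntegral N p A B) (B / powerIntegral N p A B)).indicator
    fun t => (powerIntegral N p A B * t) ^ (-p⁻¹)

variable {N : ℝ → ℝ} {p A B C L s : ℝ}

theorem IsOrliczFunction.continuousOn_comp_rpow (hN : IsOrliczFunction N) (hs : 0 ≤ s) (q : ℝ) :
    ContinuousOn (fun r => N (s * r ^ q)) (Ioi 0) :=
  hN.continuous.comp (continuousOn_const.mul fun _ hr =>
      (Real.continuousAt_rpow_const _ q (Or.inl (ne_of_gt hr))).continuousWithinAt)
    fun _ hr => mul_nonneg hs (Real.rpow_nonneg (le_of_lt hr) q)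

theorem IsOrliczFunction.intervalIntegrable_rpow (hN : IsOrliczFunction N) (q : ℝ) (hA : 0 < A)
    (hB : 0 < B) : IntervalIntegrable (fun r => N (r ^ q)) volume A B := by
  simpa only [one_mul] using ((hN.continuousOn_comp_rpow zero_le_one q).mono fun _ hr =>
    (lt_min hA hB).trans_le hr.1).intervalIntegrable

theorem powerIntegral_add (hN : IsOrliczFunction N) (hA : 0 < A) (hB : 0 < B) (hC : 0 < C) :
    powerIntegral N p A B + powerIntegral N p B C = powerIntegral N p A C :=
  intervalIntegral.integral_add_adjacent_intervals (hN.intervalIntegrable_rpow _ hA hB)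
    (hN.intervalIntegrable_rpow _ hB hC)

theorem powerIntegral_nonneg (hN : IsOrliczFunction N) (hA : 0 < A) (hAB : A ≤ B) :
    0 ≤ powerIntegral N p A B :=
  intervalIntegral.integral_nonneg hAB fun _ hr =>
    hN.nonneg (Real.rpow_nonneg (hA.le.trans hr.1) _)

theorem powerIntegral_pos (hN : IsOrliczFunction N) (hA : 0 < A) (hAB : A < B) :
    0 < powerIntegral N p A B :=
  intervalIntegral.intervalIntegral_pos_of_pos_on
    (hN.intervalIntegrable_rpow _ hA (hA.trans hAB))
    (fun _ hr => hN.pos (Real.rpow_pos_of_pos (hA.trans hr.1) _)) hAB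

theorem powerIntegral_mono_right (hN : IsOrliczFunction N) (hA : 0 < A) (hAB : A ≤ B)
    (hBC : B ≤ C) : powerIntegral N p A B ≤ powerIntegral N p A C := by
  have hB := hA.trans_le hAB
  rw [← powerIntegral_add hN hA hB (hB.trans_le hBC)]
  exact le_add_of_nonneg_right (powerIntegral_nonneg hN hB hBC)

theorem abs_powerIntegral_mul_sub_le (hN : IsOrliczFunction N) (hA : 0 < A) (hB : 0 < B) {c : ℝ}
    (hc : 1 ≤ c) (hcL : c ≤ L) :
    |powerIntegral N p (c * A) (c * B) - powerIntegral N p A B| ≤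
      powerIntegral N p A (L * A) + powerIntegral N p B (L * B) := by
  have hc0 : 0 < c := by positivity
  have hend : ∀ D > 0, 0 ≤ powerIntegral N p D (c * D) ∧
      powerIntegral N p D (c * D) ≤ powerIntegral N p D (L * D) := fun D hD =>
    have hle : D ≤ c * D := le_mul_of_one_le_left hD.le hc
    ⟨powerIntegral_nonneg hN hD hle, powerIntegral_mono_right hN hD hle (by gcongr)⟩
  have hsplit : powerIntegral N p (c * A) (c * B) - powerIntegral N p A B =
      powerIntegral N p B (c * B) - powerIntegral N p A (c * A) := by
    linarith [powerIntegral_add (p := p) hN hA hB (mul_pos hc0 hB),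
      powerIntegral_add (p := p) hN hA (mul_pos hc0 hA) (mul_pos hc0 hB)]
  rw [hsplit, abs_le]
  constructor <;> linarith [hend A hA, hend B hB]

theorem integral_orlicz_mul_rpow (hp : p ≠ 0) (hA : 0 < A) (hB : 0 < B) (hs : 0 < s) :
    ∫ r in A..B, N (s * r ^ (-p⁻¹)) =
      s ^ p * powerIntegral N p ((s ^ p)⁻¹ * A) ((s ^ p)⁻¹ * B) := by
  have hc : 0 < (s ^ p)⁻¹ := by positivity
  have hsub := intervalIntegral.integral_comp_mul_left (a := A) (b := B)
    (fun r => N (r ^ (-p⁻¹))) hc.ne'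
  rw [inv_inv, smul_eq_mul] at hsub
  rw [powerIntegral, ← hsub]
  refine intervalIntegral.integral_congr fun r hr => ?_
  have hr0 : 0 < r := (lt_min hA hB).trans_le hr.1
  rw [Real.mul_rpow hc.le hr0.le, ← Real.rpow_neg hs.le, ← Real.rpow_mul hs.le, neg_mul_neg,
    mul_inv_cancel₀ hp, Real.rpow_one]

theorem measurable_powerBump : Measurable (powerBump N p A B) :=
  Measurable.indicator (by fun_prop) measurableSet_Ioc

theorem support_powerBump_subset (hN : IsOrliczFunction N) (hA : 0 < A) (hAB : A < B) :
    (powerBump N p A B).support ⊆ Ioc 0 (B / powerIntegral N p A B) :=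
  support_indicator_subset.trans
    (Ioc_subset_Ioc_left (div_pos hA (powerIntegral_pos hN hA hAB)).le)

theorem orliczModular_powerBump (hN : IsOrliczFunction N) (hA : 0 < A) (hAB : A < B)
    (hs : 0 ≤ s) : orliczModular N (powerBump N p A B) s =
      ENNReal.ofReal ((∫ r in A..B, N (s * r ^ (-p⁻¹))) / powerIntegral N p A B) := by
  have hI := powerIntegral_pos (p := p) hN hA hAB
  set I := powerIntegral N p A B with hIdef
  have hle : A / I ≤ B / I := by gcongr
  have hpos : ∀ t ∈ Ioc (A / I) (B / I), 0 < I * t := fun t ht =>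
    mul_pos hI ((div_pos hA hI).trans ht.1)
  have hindicator : (fun t => ENNReal.ofReal (N (s * |powerBump N p A B t|))) =
      (Ioc (A / I) (B / I)).indicator fun t => ENNReal.ofReal (N (s * (I * t) ^ (-p⁻¹))) := by
    ext t
    by_cases ht : t ∈ Ioc (A / I) (B / I)
    · simp only [powerBump, ← hIdef, indicator_of_mem ht,
        abs_of_pos (Real.rpow_pos_of_pos (hpos t ht) _)]
    · simp only [powerBump, ← hIdef, indicator_of_notMem ht, abs_zero, mul_zero, hN.map_zero,
        ENNReal.ofReal_zero]
  have hint : IntervalIntegrable (fun t => N (s * (I * t) ^ (-p⁻¹))) volume (A / I) (B / I) := by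
    refine ((hN.continuousOn_comp_rpow hs _).comp (by fun_prop) fun t ht => ?_).intervalIntegrable
    rw [uIcc_of_le hle] at ht
    exact mul_pos hI ((div_pos hA hI).trans_le ht.1)
  rw [orliczModular, hindicator, halfLine, setLIntegral_indicator measurableSet_Ioc,
    inter_eq_left.2 (Ioc_subset_Ioi_self.trans (Ioi_subset_Ioi (div_pos hA hI).le)),
    ← ofReal_integral_eq_lintegral_ofReal, ← intervalIntegral.integral_of_le hle,
    intervalIntegral.integral_comp_mul_left (fun r => N (s * r ^ (-p⁻¹))) hI.ne',
    mul_div_cancel₀ _ hI.ne', mul_div_cancel₀ _ hI.ne', smul_eq_mul, div_eq_inv_mul]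
  · exact (intervalIntegrable_iff_integrableOn_Ioc_of_le hle).1 hint
  · exact (ae_restrict_mem measurableSet_Ioc).mono fun t ht =>
      hN.nonneg (mul_nonneg hs (Real.rpow_nonneg (hpos t ht).le _))

theorem orliczModular_powerBump_bounds (hN : IsOrliczFunction N) (hp : p ≠ 0) (hA : 0 < A)
    (hAB : A < B) (hs : 0 < s) (hsp : s ^ p ≤ 1) (hL : (s ^ p)⁻¹ ≤ L) {ε : ℝ}
    (h : powerIntegral N p A (L * A) + powerIntegral N p B (L * B) ≤ ε * powerIntegral N p A B) :
    ENNReal.ofReal (s ^ p - ε) ≤ orliczModular N (powerBump N p A B) s ∧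
      orliczModular N (powerBump N p A B) s ≤ ENNReal.ofReal (s ^ p + ε) := by
  have hI := powerIntegral_pos (p := p) hN hA hAB
  have hsp0 : 0 < s ^ p := by positivity
  have hdev := (abs_powerIntegral_mul_sub_le (p := p) hN hA (hA.trans hAB)
    ((one_le_inv₀ hsp0).2 hsp) hL).trans h
  rw [orliczModular_powerBump hN hA hAB hs.le, integral_orlicz_mul_rpow hp hA (hA.trans hAB) hs]
  set I := powerIntegral N p A B
  set J := powerIntegral N p ((s ^ p)⁻¹ * A) ((s ^ p)⁻¹ * B)
  have hscaled : |s ^ p * J - s ^ p * I| ≤ ε * I := by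
    rw [← mul_sub, abs_mul, abs_of_pos hsp0]
    exact (mul_le_of_le_one_left (abs_nonneg _) hsp).trans hdev
  rw [abs_le] at hscaled
  constructor <;> refine ENNReal.ofReal_le_ofReal ?_
  · rw [le_div_iff₀ hI]; linarith
  · rw [div_le_iff₀ hI]; linarith

theorem HasBroadWindows.exists_powerBump (h : HasBroadWindows N p) (hN : IsOrliczFunction N)
    (hp : 0 < p) {δ : ℝ} (hδ : 0 < δ) : ∃ A B : ℝ, 0 < A ∧ A < B ∧ ∀ s ∈ Icc (0 : ℝ) 1,
      ENNReal.ofReal (s ^ p - δ) ≤ orliczModular N (powerBump N p A B) s ∧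
        orliczModular N (powerBump N p A B) s ≤ ENNReal.ofReal (s ^ p + δ) := by
  set L : ℝ := max 2 (2 / δ)
  have hL1 : 1 < L := one_lt_two.trans_le (le_max_left _ _)
  have hL0 : 0 < L := zero_lt_one.trans hL1
  have hLδ : L⁻¹ ≤ δ / 2 := by
    rw [inv_le_comm₀ hL0 (by positivity), inv_div]
    exact le_max_right _ _
  obtain ⟨A, B, hA, hAB, hwindow⟩ := h L (δ / 2) hL1 (by positivity)
  refine ⟨A, B, hA, hAB, fun s ⟨hs0, hs1⟩ => ?_⟩
  rcases le_or_gt L⁻¹ (s ^ p) with hlarge | hsmall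
  · have hs : 0 < s := hs0.lt_of_ne fun h0 => by
      rw [← h0, Real.zero_rpow hp.ne'] at hlarge
      exact hlarge.not_gt (inv_pos.2 hL0)
    have hbounds := orliczModular_powerBump_bounds hN hp.ne' hA hAB hs
      (Real.rpow_le_one hs0 hs1 hp.le) (inv_le_of_inv_le₀ hL0 hlarge) hwindow
    exact ⟨(ENNReal.ofReal_le_ofReal (by linarith)).trans hbounds.1,
      hbounds.2.trans (ENNReal.ofReal_le_ofReal (by linarith))⟩
  · refine ⟨by rw [ENNReal.ofReal_of_nonpos (by linarith)]; exact zero_le, ?_⟩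
    have hs₀ : (L⁻¹ ^ p⁻¹) ^ p = L⁻¹ := Real.rpow_inv_rpow (inv_nonneg.2 hL0.le) hp.ne'
    have hbounds := orliczModular_powerBump_bounds hN hp.ne' hA hAB (s := L⁻¹ ^ p⁻¹)
      (by positivity) (hs₀.trans_le (inv_le_one_of_one_le₀ hL1.le)) (by rw [hs₀, inv_inv])
      hwindow
    rw [hs₀] at hbounds
    have hle : s ≤ L⁻¹ ^ p⁻¹ := by
      rw [← Real.rpow_le_rpow_iff hs0 (by positivity) hp, hs₀]
      exact hsmall.le
    have hsp : 0 ≤ s ^ p := by positivity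
    exact (orliczModular_mono hN hs0 hle).trans (hbounds.2.trans
      (ENNReal.ofReal_le_ofReal (by linarith)))

theorem orliczModular_mul_le (hN : IsOrliczFunction N) {x : ℝ → ℝ} {c : ℝ} (hc0 : 0 ≤ c)
    (hc1 : c ≤ 1) (hs : 0 ≤ s) :
    orliczModular N x (c * s) ≤ ENNReal.ofReal c * orliczModular N x s := by
  rw [orliczModular, orliczModular, ← lintegral_const_mul' _ _ ENNReal.ofReal_ne_top]
  refine lintegral_mono fun t => ?_
  rw [← ENNReal.ofReal_mul hc0, mul_assoc]
  refine ENNReal.ofReal_le_ofReal ?_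
  have hconv := hN.convex.2 (mem_Ici.2 (show 0 ≤ s * |x t| by positivity)) (mem_Ici.2 le_rfl) hc0
    (sub_nonneg.2 hc1) (add_sub_cancel _ _)
  simpa only [smul_eq_mul, mul_zero, add_zero, hN.map_zero] using hconv

theorem sum_bounds_of_forall_ofReal_bounds {ι : Type*} [Fintype ι] {φ : ι → ℝ≥0∞} {v : ι → ℝ}
    {δ : ℝ} (hv : ∀ i, 0 ≤ v i) (hδ : 0 ≤ δ)
    (h : ∀ i, ENNReal.ofReal (v i - δ) ≤ φ i ∧ φ i ≤ ENNReal.ofReal (v i + δ)) :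
    ENNReal.ofReal (∑ i, v i - Fintype.card ι * δ) ≤ ∑ i, φ i ∧
      ∑ i, φ i ≤ ENNReal.ofReal (∑ i, v i + Fintype.card ι * δ) := by
  constructor
  · calc ENNReal.ofReal (∑ i, v i - Fintype.card ι * δ)
        = ENNReal.ofReal (∑ i, (v i - δ)) := by simp
      _ ≤ ∑ i, ENNReal.ofReal (v i - δ) := Finset.le_sum_of_subadditive ENNReal.ofReal
        ENNReal.ofReal_zero.le (fun _ _ => ENNReal.ofReal_add_le) _ _
      _ ≤ ∑ i, φ i := Finset.sum_le_sum fun i _ => (h i).1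
  · calc ∑ i, φ i ≤ ∑ i, ENNReal.ofReal (v i + δ) := Finset.sum_le_sum fun i _ => (h i).2
      _ = ENNReal.ofReal (∑ i, (v i + δ)) :=
        (ENNReal.ofReal_sum_of_nonneg fun i _ => add_nonneg (hv i) hδ).symm
      _ = ENNReal.ofReal (∑ i, v i + Fintype.card ι * δ) := by simp [Finset.sum_add_distrib]

theorem sum_orliczModular_dilation_bounds {ι : Type*} [Fintype ι] (hN : IsOrliczFunction N)
    {x : ℝ → ℝ} {v : ι → ℝ} (hv : ∀ i, 0 ≤ v i) {c η : ℝ} (hc : 1 ≤ c) (hη : η < 1 - c⁻¹)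
    (hlower : ENNReal.ofReal (1 - η) ≤ ∑ i, orliczModular N x (v i))
    (hupper : ∑ i, orliczModular N x (v i) ≤ ENNReal.ofReal (1 + η)) :
    ∑ i, orliczModular N x (c⁻¹ * v i) ≤ 1 ∧ 1 < ∑ i, orliczModular N x (c * v i) := by
  have hc0 : 0 < c := zero_lt_one.trans_le hc
  have hinv0 : 0 < c⁻¹ := inv_pos.2 hc0
  have hinv1 : c⁻¹ ≤ 1 := inv_le_one_of_one_le₀ hc
  have hconvex : ∀ w : ι → ℝ, (∀ i, 0 ≤ w i) → ∑ i, orliczModular N x (c⁻¹ * w i) ≤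
      ENNReal.ofReal c⁻¹ * ∑ i, orliczModular N x (w i) := fun w hw => by
    rw [Finset.mul_sum]
    exact Finset.sum_le_sum fun i _ => orliczModular_mul_le hN hinv0.le hinv1 (hw i)
  constructor
  · refine (hconvex v hv).trans ((mul_le_mul_right hupper _).trans ?_)
    rw [← ENNReal.ofReal_mul hinv0.le, ENNReal.ofReal_le_one, inv_mul_le_one₀ hc0]
    have : (c - 1) * c⁻¹ ≤ c - 1 := mul_le_of_le_one_right (sub_nonneg.2 hc) hinv1
    rw [sub_mul, mul_inv_cancel₀ hc0.ne'] at this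
    linarith
  · by_contra! hle
    have hge := hconvex (fun i => c * v i) fun i => mul_nonneg hc0.le (hv i)
    simp only [inv_mul_cancel_left₀ hc0.ne'] at hge
    have hcontra := hlower.trans (hge.trans (mul_le_of_le_one_right' hle))
    rw [ENNReal.ofReal_le_ofReal_iff hinv0.le] at hcontra
    linarith

theorem HasBroadWindows.symmFinitelyRepresented {p : ℝ≥0∞} [Fact (1 ≤ p)] (hp : p ≠ ∞)
    (h : HasBroadWindows N p.toReal) (hN : IsOrliczFunction N) : SymmFinitelyRepresented N p := by
  have hp0 : 0 < p.toReal := ENNReal.toReal_pos (zero_lt_one.trans_le Fact.out).ne' hp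
  refine symmFinitelyRepresented_of_translates hN fun n ε hε => ?_
  set δ := ε / ((1 + ε) * (n + 1)) with hδdef
  have hδ : 0 < δ := by positivity
  have hnδ : n * δ < 1 - (1 + ε)⁻¹ := by
    rw [hδdef, ← sub_pos]
    field_simp
    linarith
  obtain ⟨A, B, hA, hAB, hbump⟩ := h.exists_powerBump hN hp0 hδ
  refine ⟨powerBump N p.toReal A B, _, measurable_powerBump, div_nonneg (hA.trans hAB).le
    (powerIntegral_pos hN hA hAB).le, support_powerBump_subset hN hA hAB, fun a ha => ?_⟩
  have hsum : ∑ k, |a k| ^ p.toReal = 1 := by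
    rw [PiLp.norm_eq_sum hp0, one_div, Real.rpow_inv_eq (by positivity) zero_le_one hp0.ne',
      Real.one_rpow] at ha
    simpa only [Real.norm_eq_abs] using ha
  obtain ⟨hlower, hupper⟩ := sum_bounds_of_forall_ofReal_bounds
    (fun k => Real.rpow_nonneg (abs_nonneg (a k)) p.toReal) hδ.le
    fun k => hbump |a k| ⟨abs_nonneg _, ha ▸ PiLp.norm_apply_le (WithLp.toLp p a) k⟩
  rw [hsum, Fintype.card_fin] at hlower hupper
  exact sum_orliczModular_dilation_bounds hN (fun k => abs_nonneg (a k)) (by linarith) hnδ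
    hlower hupper

end BroadWindows

section Top

variable {N : ℝ → ℝ}

theorem orliczModular_indicator_const (hN : IsOrliczFunction N) {b c s : ℝ} (hc : 0 ≤ c)
    (hs : 0 ≤ s) : orliczModular N ((Ioc 0 b).indicator fun _ => c) s =
      ENNReal.ofReal (b * N (s * c)) := by
  have hindicator : (fun t => ENNReal.ofReal (N (s * |(Ioc 0 b).indicator (fun _ => c) t|))) =
      (Ioc 0 b).indicator fun _ => ENNReal.ofReal (N (s * c)) := by
    ext t
    by_cases ht : t ∈ Ioc 0 b
    · simp only [indicator_of_mem ht, abs_of_nonneg hc]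
    · simp only [indicator_of_notMem ht, abs_zero, mul_zero, hN.map_zero, ENNReal.ofReal_zero]
  rw [orliczModular, hindicator, halfLine, setLIntegral_indicator measurableSet_Ioc,
    inter_eq_left.2 Ioc_subset_Ioi_self, setLIntegral_const, Real.volume_Ioc, sub_zero, mul_comm,
    ENNReal.ofReal_mul' (hN.nonneg (by positivity))]

theorem exists_abs_eq_one_of_norm_top_eq_one {ι : Type*} [Fintype ι] {a : ι → ℝ}
    (ha : ‖WithLp.toLp ∞ a‖ = 1) : ∃ k, |a k| = 1 := by
  rw [PiLp.norm_eq_ciSup] at ha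
  have : Nonempty ι := by
    by_contra! hempty
    rw [Real.iSup_of_isEmpty] at ha
    exact zero_ne_one ha
  obtain ⟨k, hk⟩ := exists_eq_ciSup_of_finite (f := fun k => |a k|)
  exact ⟨k, hk.trans ha⟩

theorem symmFinitelyRepresented_top (hN : IsOrliczFunction N)
    (h : ∀ c > 1, ∀ M : ℝ, ∃ t > 0, M * N t < N (c * t)) : SymmFinitelyRepresented N ∞ := by
  refine symmFinitelyRepresented_of_translates hN fun n ε hε => ?_
  obtain ⟨t, ht, hlt⟩ := h (1 + ε) (by linarith) n
  set u := (1 + ε) * t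
  have hu : 0 < u := by positivity
  have hNu : 0 < N u := hN.pos hu
  refine ⟨(Ioc 0 (N u)⁻¹).indicator fun _ => u, _, measurable_const.indicator measurableSet_Ioc,
    inv_nonneg.2 hNu.le, support_indicator_subset, fun a ha => ?_⟩
  set f : ℝ → ℝ := (Ioc 0 (N u)⁻¹).indicator fun _ => u
  constructor
  · have hterm : ∀ k, orliczModular N f ((1 + ε)⁻¹ * |a k|) ≤ ENNReal.ofReal ((N u)⁻¹ * N t) := by
      intro k
      refine (orliczModular_mono hN (by positivity) (mul_le_of_le_one_right (by positivity)
        (ha ▸ PiLp.norm_apply_le (WithLp.toLp ∞ a) k))).trans_eq ?_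
      rw [orliczModular_indicator_const hN hu.le (by positivity),
        inv_mul_cancel_left₀ (by positivity)]
    refine (Finset.sum_le_sum fun k _ => hterm k).trans ?_
    rw [Finset.sum_const, Finset.card_univ, Fintype.card_fin, ← ENNReal.ofReal_nsmul,
      ENNReal.ofReal_le_one, nsmul_eq_mul, mul_left_comm, inv_mul_le_one₀ hNu]
    exact hlt.le
  · obtain ⟨k, hk⟩ := exists_abs_eq_one_of_norm_top_eq_one ha
    refine lt_of_lt_of_le ?_ (Finset.single_le_sum
      (f := fun k => orliczModular N f ((1 + ε) * |a k|)) (fun _ _ => zero_le)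
      (Finset.mem_univ k))
    simp only [f]
    rw [hk, mul_one, orliczModular_indicator_const hN hu.le (by positivity),
      ENNReal.one_lt_ofReal, one_lt_inv_mul₀ hNu]
    exact hN.increasing hu.le (mem_Ici.2 (by positivity)) (lt_mul_of_one_lt_left hu (by linarith))

theorem upperGrowth_of_forall_le_mul (hN : IsOrliczFunction N) {c M : ℝ} (hc : 1 < c)
    (h : ∀ t > 0, N (c * t) ≤ M * N t) : ∃ q > 0, UpperGrowth N (Ioi 0) q := by
  have hc0 : 0 < c := zero_lt_one.trans hc
  have hmax : 1 < max M c := hc.trans_le (le_max_right _ _)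
  refine ⟨Real.logb c (max M c), Real.logb_pos hc hmax, ?_⟩
  rw [← zpowHull_univ hc, upperGrowth_zpowHull_iff hc ordConnected_univ
    (hN.increasing.monotoneOn.mono Ioi_subset_Ici_self) (fun t ht => hN.nonneg (le_of_lt ht))
    (Real.logb_pos hc hmax).le, Real.rpow_logb hc0 hc.ne' (zero_lt_one.trans hmax)]
  refine ⟨1, one_pos, fun i _ n _ => ?_⟩
  rw [one_mul]
  induction n with
  | zero => simp
  | succ n ih =>
    have hNn := hN.nonneg (zpow_pos hc0 (i + n)).le
    calc N (c ^ (i + (n + 1 : ℕ))) = N (c * c ^ (i + n : ℤ)) := by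
          rw [Nat.cast_succ, ← add_assoc, zpow_add_one₀ hc0.ne', mul_comm]
      _ ≤ M * N (c ^ (i + n : ℤ)) := h _ (by positivity)
      _ ≤ max M c * N (c ^ (i + n : ℤ)) := by gcongr; exact le_max_left _ _
      _ ≤ max M c * (max M c ^ n * N (c ^ i)) := by gcongr; exact ih (mem_univ _)
      _ = max M c ^ (n + 1) * N (c ^ i) := by ring

theorem symmFinitelyRepresented_top_of_orliczAlpha_nonpos (hN : IsOrliczFunction N)
    (h : orliczAlpha N ≤ 0) : SymmFinitelyRepresented N ∞ := by
  refine symmFinitelyRepresented_top hN fun c hc M => ?_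
  by_contra! hgrowth
  obtain ⟨q, hq, hupper⟩ := upperGrowth_of_forall_le_mul hN hc hgrowth
  exact h.not_gt ((lt_orliczAlpha_iff hN le_rfl).2 ⟨q, hq, by simp, hupper⟩)

end Top

section EndpointDomination

/-- Sums of `g` over intervals of integers are comparable to the larger of the two endpoint values.
A nonnegative such sequence is geometric, or has a valley with geometric slopes. -/
def EndpointDominated (θ : ℝ) (g : ℤ → ℝ) : Prop :=
  ∀ i j, i ≤ j → θ * ∑ k ∈ Finset.Icc i j, g k ≤ max (g i) (g j)

/-- `g` grows on `K` at least like a geometric sequence of ratio `> 1`, up to a constant. -/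
def GeometricGrowthOn (g : ℤ → ℝ) (K : Set ℤ) : Prop :=
  ∃ θ > 0, ∃ ρ > 1, ∀ i ∈ K, ∀ n : ℕ, i + n ∈ K → θ * ρ ^ n * g i ≤ g (i + n)

/-- `g` decays on `K` at least like a geometric sequence of ratio `< 1`, up to a constant. -/
def GeometricDecayOn (g : ℤ → ℝ) (K : Set ℤ) : Prop :=
  ∃ θ > 0, ∃ ρ > 1, ∀ i ∈ K, ∀ n : ℕ, i + n ∈ K → θ * ρ ^ n * g (i + n) ≤ g i

variable {g : ℤ → ℝ} {θ : ℝ} {m T : ℤ}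

theorem EndpointDominated.comp_neg (h : EndpointDominated θ g) :
    EndpointDominated θ fun k => g (-k) := fun i j hij => by
  have hsum : ∑ k ∈ Finset.Icc i j, g (-k) = ∑ k ∈ Finset.Icc (-j) (-i), g k :=
    Finset.sum_equiv (Equiv.neg ℤ)
      (fun k => by simp only [Finset.mem_Icc, Equiv.neg_apply, neg_le_neg_iff, and_comm])
      fun _ _ => rfl
  rw [hsum, max_comm]
  exact h _ _ (neg_le_neg hij)

theorem EndpointDominated.growth_of_forall_le (h : EndpointDominated θ g) (hg : ∀ k, 0 ≤ g k)
    (hθ : 0 < θ) (hm : ∀ k ∈ Finset.Icc m T, g m ≤ g k) {i : ℤ} (hi : m ≤ i) {n : ℕ}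
    (hT : i + n ≤ T) : θ * (1 + θ) ^ n * g i ≤ g (i + n) := by
  set S : ℤ → ℝ := fun j => ∑ k ∈ Finset.Icc m j, g k with hS
  have hlast : ∀ j, m ≤ j → j ≤ T → θ * S j ≤ g j := fun j hmj hjT =>
    (h m j hmj).trans_eq (max_eq_right (hm j (Finset.mem_Icc.2 ⟨hmj, hjT⟩)))
  have hstep : ∀ j, m ≤ j → j < T → (1 + θ) * S j ≤ S (j + 1) := fun j hmj hjT => by
    have hsucc : S (j + 1) = g (j + 1) + S j := by
      simp only [hS]
      rw [← Finset.insert_Icc_right_eq_Icc_add_one (by omega), Finset.sum_insert (by simp)]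
    have hSj : θ * S j ≤ θ * S (j + 1) := by
      rw [hsucc]
      gcongr
      exact le_add_of_nonneg_left (hg _)
    linarith [hlast (j + 1) (by omega) hjT]
  have hgeom : ∀ n : ℕ, i + n ≤ T → (1 + θ) ^ n * g i ≤ S (i + n) := by
    intro n hn
    induction n with
    | zero =>
      simpa using Finset.single_le_sum (fun k _ => hg k) (Finset.mem_Icc.2 ⟨hi, le_refl i⟩)
    | succ n ih =>
      push_cast at hn ⊢
      rw [← add_assoc, pow_succ', mul_assoc]
      exact (mul_le_mul_of_nonneg_left (ih (by omega)) (by positivity)).trans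
        (hstep _ (by omega) (by omega))
  rw [mul_assoc]
  exact (mul_le_mul_of_nonneg_left (hgeom n hT) hθ.le).trans (hlast _ (by omega) hT)

theorem EndpointDominated.decay_of_forall_le (h : EndpointDominated θ g) (hg : ∀ k, 0 ≤ g k)
    (hθ : 0 < θ) (hm : ∀ k ∈ Finset.Icc T m, g m ≤ g k) {i : ℤ} {n : ℕ} (hi : i + n ≤ m)
    (hT : T ≤ i) : θ * (1 + θ) ^ n * g (i + n) ≤ g i := by
  have hgrowth := h.comp_neg.growth_of_forall_le (fun k => hg (-k)) hθ (m := -m) (T := -T)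
    (fun k hk => by
      rw [neg_neg]
      rw [Finset.mem_Icc] at hk
      exact hm _ (Finset.mem_Icc.2 ⟨by omega, by omega⟩))
    (i := -(i + n)) (neg_le_neg hi) (n := n) (by omega)
  simpa using hgrowth

theorem EndpointDominated.geometric_of_forall_ge (h : EndpointDominated θ g) (hg : ∀ k, 0 ≤ g k)
    (hθ : 0 < θ) (hm : ∀ k, g m ≤ g k) :
    GeometricDecayOn g (Iic m) ∧ GeometricGrowthOn g (Ici m) :=
  ⟨⟨θ, hθ, 1 + θ, by linarith, fun _ _ _ hn => h.decay_of_forall_le hg hθ (fun k _ => hm k) hn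
      le_rfl⟩,
    ⟨θ, hθ, 1 + θ, by linarith, fun _ hi _ _ => h.growth_of_forall_le hg hθ (fun k _ => hm k) hi
      le_rfl⟩⟩

theorem EndpointDominated.geometric_trichotomy (h : EndpointDominated θ g) (hg : ∀ k, 0 ≤ g k)
    (hθ : 0 < θ) : GeometricGrowthOn g univ ∨ GeometricDecayOn g univ ∨
      ∃ m, GeometricDecayOn g (Iic m) ∧ GeometricGrowthOn g (Ici m) := by
  by_contra! hcon
  obtain ⟨hgrowth, hdecay, hvalley⟩ := hcon
  obtain ⟨i, n, hin⟩ : ∃ i, ∃ n : ℕ, g (i + n) < θ * (1 + θ) ^ n * g i := by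
    by_contra! H
    exact hgrowth ⟨θ, hθ, 1 + θ, by linarith, fun i _ n _ => H i n⟩
  obtain ⟨j, l, hjl⟩ : ∃ j, ∃ l : ℕ, g j < θ * (1 + θ) ^ l * g (j + l) := by
    by_contra! H
    exact hdecay ⟨θ, hθ, 1 + θ, by linarith, fun j _ l _ => H j l⟩
  have hargmin : ∀ k, ∃ w ∈ Finset.Icc i (j + l), g w ≤ g k := by
    intro k
    obtain ⟨w, hw, hmin⟩ := Finset.exists_min_image
      (Finset.Icc (min k j) (max k (i + n))) g ⟨k, by simp⟩
    rw [Finset.mem_Icc] at hw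
    refine ⟨w, Finset.mem_Icc.2 ⟨?_, ?_⟩, hmin k (by simp)⟩
    · by_contra! hwi
      exact hin.not_ge (h.growth_of_forall_le hg hθ
        (fun _ hr => hmin _ (Finset.Icc_subset_Icc_left hw.1 hr)) hwi.le (le_max_right _ _))
    · by_contra! hwj
      exact hjl.not_ge (h.decay_of_forall_le hg hθ
        (fun _ hr => hmin _ (Finset.Icc_subset_Icc_right hw.2 hr)) hwj.le (min_le_right _ _))
  obtain ⟨m, -, hm⟩ := Finset.exists_min_image (Finset.Icc i (j + l)) g
    ((hargmin i).imp fun _ hw => hw.1)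
  have hmin : ∀ k, g m ≤ g k := fun k =>
    let ⟨w, hw, hwk⟩ := hargmin k
    (hm w hw).trans hwk
  obtain ⟨hleft, hright⟩ := h.geometric_of_forall_ge hg hθ hmin
  exact hvalley m hleft hright

end EndpointDomination

section PowerBlocks

/-- The integral of `N (r^{-1/p})` over the window on which `r^{-1/p}` runs from `a ^ (k + 1)` down
to `a ^ k`. Up to bounded shifts in `k` it is the value `a ^ (-p * k) * N (a ^ k)`. -/
noncomputable def powerBlock (N : ℝ → ℝ) (p a : ℝ) (k : ℤ) : ℝ :=
  powerIntegral N p ((a ^ p) ^ (-k - 1)) ((a ^ p) ^ (-k))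

variable {N : ℝ → ℝ} {p a : ℝ} {K : Set ℤ}

theorem zpow_rpow_rpow_neg_inv (hp : p ≠ 0) (ha : 0 < a) (k : ℤ) :
    ((a ^ p) ^ (-k)) ^ (-p⁻¹) = a ^ k := by
  rw [← Real.rpow_intCast, ← Real.rpow_mul ha.le, ← Real.rpow_mul ha.le, ← Real.rpow_intCast]
  congr 1
  push_cast
  field_simp

theorem powerBlock_nonneg (hN : IsOrliczFunction N) (hp : 0 < p) (ha : 1 < a) (k : ℤ) :
    0 ≤ powerBlock N p a k :=
  have hL : 1 < a ^ p := Real.one_lt_rpow ha hp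
  powerIntegral_nonneg hN (zpow_pos (one_pos.trans hL) _)
    (zpow_le_zpow_right₀ hL.le (sub_one_lt _).le)

theorem powerBlock_bounds (hN : IsOrliczFunction N) (hp : 0 < p) (ha : 1 < a) (k : ℤ) :
    (a ^ p - 1) * (a ^ p) ^ (-k - 1) * N (a ^ k) ≤ powerBlock N p a k ∧
      powerBlock N p a k ≤ (a ^ p - 1) * (a ^ p) ^ (-k - 1) * N (a ^ (k + 1)) := by
  have ha0 : 0 < a := one_pos.trans ha
  have hL : 1 < a ^ p := Real.one_lt_rpow ha hp
  have hL0 : 0 < a ^ p := one_pos.trans hL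
  have hA : 0 < (a ^ p) ^ (-k - 1) := zpow_pos hL0 _
  have hB : 0 < (a ^ p) ^ (-k) := zpow_pos hL0 _
  have hle : (a ^ p) ^ (-k - 1) ≤ (a ^ p) ^ (-k) := zpow_le_zpow_right₀ hL.le (by omega)
  have hlength : (a ^ p) ^ (-k) - (a ^ p) ^ (-k - 1) = (a ^ p - 1) * (a ^ p) ^ (-k - 1) := by
    rw [zpow_sub_one₀ hL0.ne']
    field_simp
  have hp' : -p⁻¹ ≤ 0 := neg_nonpos.2 (inv_nonneg.2 hp.le)
  have hint := hN.intervalIntegrable_rpow (-p⁻¹) hA hB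
  rw [← hlength, ← smul_eq_mul, ← smul_eq_mul, ← intervalIntegral.integral_const,
    ← intervalIntegral.integral_const]
  constructor
  · refine intervalIntegral.integral_mono_on hle intervalIntegrable_const hint fun r hr => ?_
    refine hN.mono (zpow_pos ha0 k).le ?_
    rw [← zpow_rpow_rpow_neg_inv hp.ne' ha0 k]
    exact Real.rpow_le_rpow_of_nonpos (hA.trans_le hr.1) hr.2 hp'
  · refine intervalIntegral.integral_mono_on hle hint intervalIntegrable_const fun r hr => ?_
    refine hN.mono (Real.rpow_nonneg (hA.le.trans hr.1) _) ?_
    rw [← zpow_rpow_rpow_neg_inv hp.ne' ha0 (k + 1), neg_add, ← sub_eq_add_neg]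
    exact Real.rpow_le_rpow_of_nonpos hA hr.1 hp'

theorem sum_powerBlock (hN : IsOrliczFunction N) (ha : 0 < a) {i j : ℤ} (hij : i ≤ j) :
    ∑ k ∈ Finset.Icc i j, powerBlock N p a k =
      powerIntegral N p ((a ^ p) ^ (-j - 1)) ((a ^ p) ^ (-i)) := by
  have hpos : ∀ k : ℤ, 0 < (a ^ p) ^ k := zpow_pos (Real.rpow_pos_of_pos ha p)
  induction j, hij using Int.leInduction with
  | base => rw [Finset.Icc_self, Finset.sum_singleton, powerBlock]
  | succ j hij ih =>
    rw [← Finset.insert_Icc_right_eq_Icc_add_one (by omega), Finset.sum_insert (by simp), ih,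
      powerBlock, neg_add', powerIntegral_add hN (hpos _) (hpos _) (hpos _)]

theorem exists_endpointDominated_powerBlock (hN : IsOrliczFunction N) (hp : 0 < p)
    (h : ¬ HasBroadWindows N p) :
    ∃ a > 1, ∃ θ > 0, EndpointDominated θ (powerBlock N p a) := by
  unfold HasBroadWindows at h
  push Not at h
  obtain ⟨L, ε, hL, hε, hnarrow⟩ := h
  have hL0 : 0 < L := one_pos.trans hL
  have ha : 1 < L ^ p⁻¹ := Real.one_lt_rpow hL (inv_pos.2 hp)
  refine ⟨L ^ p⁻¹, ha, ε / (2 + ε), by positivity, fun i j hij => ?_⟩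
  set b := powerBlock N p (L ^ p⁻¹) with hb
  have hbi : 0 ≤ b i := powerBlock_nonneg hN hp ha i
  rw [div_mul_eq_mul_div, div_le_iff₀ (by positivity)]
  rcases hij.eq_or_lt with rfl | hlt
  · rw [Finset.Icc_self, Finset.sum_singleton, max_self, mul_comm]
    gcongr
    linarith
  · have hpos : ∀ k : ℤ, 0 < L ^ k := zpow_pos hL0
    have hmul : ∀ k : ℤ, L * L ^ (k - 1) = L ^ k := fun k => by
      rw [← zpow_one_add₀ hL0.ne', add_sub_cancel]
    have hwindow := hnarrow (L ^ (-j - 1)) (L ^ (-i - 1)) (hpos _)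
      (zpow_lt_zpow_right₀ hL (by omega))
    have hsum := sum_powerBlock (p := p) hN (one_pos.trans ha) hij
    rw [Real.rpow_inv_rpow hL0.le hp.ne',
      ← powerIntegral_add hN (hpos _) (hpos (-i - 1)) (hpos _)] at hsum
    have hblock : ∀ k, powerIntegral N p (L ^ (-k - 1)) (L ^ (-k)) = b k := fun k => by
      rw [hb, powerBlock, Real.rpow_inv_rpow hL0.le hp.ne']
    rw [hmul, hmul, hblock, hblock] at hwindow
    rw [hblock] at hsum
    rw [hsum]
    nlinarith [le_max_left (b i) (b j), le_max_right (b i) (b j)]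

theorem mul_map_zpow_le_of_mul_powerBlock_le (hN : IsOrliczFunction N) (hp : 0 < p) (ha : 1 < a)
    {c : ℝ} (hc : 0 ≤ c) {i j : ℤ} (h : c * powerBlock N p a i ≤ powerBlock N p a j) :
    c * (a ^ p) ^ (j - i) * N (a ^ i) ≤ N (a ^ (j + 1)) := by
  have hL : 1 < a ^ p := Real.one_lt_rpow ha hp
  have hL0 : 0 < a ^ p := one_pos.trans hL
  have hfactor : 0 < (a ^ p - 1) * (a ^ p) ^ (-j - 1) :=
    mul_pos (sub_pos.2 hL) (zpow_pos hL0 _)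
  have hscale : (a ^ p) ^ (-i - 1) = (a ^ p) ^ (-j - 1) * (a ^ p) ^ (j - i) := by
    rw [← zpow_add₀ hL0.ne']
    congr 1
    ring
  refine le_of_mul_le_mul_left ?_ hfactor
  calc _ = c * ((a ^ p - 1) * (a ^ p) ^ (-i - 1) * N (a ^ i)) := by rw [hscale]; ring
    _ ≤ c * powerBlock N p a i := by gcongr; exact (powerBlock_bounds hN hp ha i).1
    _ ≤ _ := h.trans (powerBlock_bounds hN hp ha j).2

theorem GeometricGrowthOn.exists_lowerGrowth (h : GeometricGrowthOn (powerBlock N p a) K)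
    (hN : IsOrliczFunction N) (hp : 0 < p) (ha : 1 < a) (hK : K.OrdConnected) :
    ∃ q > p, LowerGrowth N (zpowHull a K) q := by
  obtain ⟨θ, hθ, ρ, hρ, H⟩ := h
  have ha0 : 0 < a := one_pos.trans ha
  have hL0 : 0 < a ^ p := Real.rpow_pos_of_pos ha0 p
  have hR : a ^ p < ρ * a ^ p := lt_mul_of_one_lt_left hL0 hρ
  have hR0 : 0 < ρ * a ^ p := hL0.trans hR
  have hq : p < Real.logb a (ρ * a ^ p) := (Real.lt_logb_iff_rpow_lt ha hR0).2 hR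
  refine ⟨_, hq, (lowerGrowth_zpowHull_iff ha hK
    (hN.increasing.monotoneOn.mono Ioi_subset_Ici_self) (fun t ht => hN.nonneg (le_of_lt ht))
    (hp.le.trans hq.le)).2 ⟨max 1 (ρ * a ^ p / θ), by positivity, fun i hi n hn => ?_⟩⟩
  rw [Real.rpow_logb ha0 ha.ne' hR0]
  have hNn : 0 ≤ N (a ^ (i + n)) := hN.nonneg (zpow_pos ha0 _).le
  cases n with
  | zero => simpa using le_mul_of_one_le_left hNn (le_max_left 1 (ρ * a ^ p / θ))
  | succ n =>
    have hstep := mul_map_zpow_le_of_mul_powerBlock_le hN hp ha (by positivity)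
      (H i hi n (hK.out hi hn ⟨by omega, by push_cast; omega⟩))
    rw [add_sub_cancel_left, zpow_natCast] at hstep
    rw [Nat.cast_succ, ← add_assoc] at hNn ⊢
    refine le_trans ?_ (mul_le_mul_of_nonneg_right (le_max_right 1 (ρ * a ^ p / θ)) hNn)
    rw [div_mul_eq_mul_div, le_div_iff₀ hθ]
    calc _ = ρ * a ^ p * (θ * ρ ^ n * (a ^ p) ^ n * N (a ^ i)) := by ring
      _ ≤ _ := by gcongr

theorem GeometricDecayOn.exists_upperGrowth (h : GeometricDecayOn (powerBlock N p a) K)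
    (hN : IsOrliczFunction N) (hp : 0 < p) (ha : 1 < a) (hK : IsLowerSet K) :
    ∃ q > 0, q < p ∧ UpperGrowth N (zpowHull a K) q := by
  obtain ⟨θ, hθ, ρ, hρ, H⟩ := h
  have ha0 : 0 < a := one_pos.trans ha
  have : 0 < ρ := one_pos.trans hρ
  have hL : 1 < a ^ p := Real.one_lt_rpow ha hp
  have hL0 : 0 < a ^ p := one_pos.trans hL
  obtain ⟨R, hmax, hRL⟩ := exists_between (max_lt hL (div_lt_self hL0 hρ))
  obtain ⟨hR1, hR⟩ := max_lt_iff.1 hmax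
  have hR0 : 0 < R := one_pos.trans hR1
  have hq : 0 < Real.logb a R := Real.logb_pos ha hR1
  refine ⟨_, hq, (Real.logb_lt_iff_lt_rpow ha hR0).2 hRL, (upperGrowth_zpowHull_iff ha
    hK.ordConnected (hN.increasing.monotoneOn.mono Ioi_subset_Ici_self)
    (fun t ht => hN.nonneg (le_of_lt ht)) hq.le).2 ⟨R / θ, by positivity, fun i hi n hn => ?_⟩⟩
  rw [Real.rpow_logb ha0 ha.ne' hR0]
  have hNi : 0 ≤ N (a ^ i) := hN.nonneg (zpow_pos ha0 i).le
  have hexp : i - 1 + (n + 1 : ℕ) = i + n := by push_cast; ring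
  have hdecay := H (i - 1) (hK (by omega) hi) (n + 1) (by rwa [hexp])
  have hstep := mul_map_zpow_le_of_mul_powerBlock_le hN hp ha (by positivity) hdecay
  rw [hexp, sub_add_cancel, show i - 1 - (i + n) = -((n + 1 : ℕ) : ℤ) by push_cast; ring,
    zpow_neg, zpow_natCast] at hstep
  have hscaled : θ * N (a ^ (i + n)) ≤ (a ^ p / ρ) ^ (n + 1) * N (a ^ i) := by
    rw [div_pow, div_mul_eq_mul_div, le_div_iff₀ (by positivity)]
    calc _ = (a ^ p) ^ (n + 1) *
          (θ * ρ ^ (n + 1) * ((a ^ p) ^ (n + 1))⁻¹ * N (a ^ (i + n))) := by field_simp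
      _ ≤ _ := by gcongr
  rw [div_mul_eq_mul_div, div_mul_eq_mul_div, le_div_iff₀ hθ, ← pow_succ', mul_comm]
  exact hscaled.trans (by gcongr)

theorem indices_of_not_hasBroadWindows (hN : IsOrliczFunction N) (hp : 0 < p)
    (h : ¬ HasBroadWindows N p) : orliczBeta N < p⁻¹ ∨ p⁻¹ < orliczAlpha N ∨
      (orliczBetaZero N < p⁻¹ ∧ p⁻¹ < orliczAlphaInfty N) := by
  have hp' : 0 < p⁻¹ := inv_pos.2 hp
  obtain ⟨a, ha, θ, hθ, hdom⟩ := exists_endpointDominated_powerBlock hN hp h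
  have hlower : ∀ K : Set ℤ, K.OrdConnected → GeometricGrowthOn (powerBlock N p a) K →
      ∃ q > 0, 1 < p⁻¹ * q ∧ LowerGrowth N (zpowHull a K) q := fun K hK hgrowth =>
    let ⟨q, hq, hqK⟩ := hgrowth.exists_lowerGrowth hN hp ha hK
    ⟨q, hp.trans hq, (one_lt_inv_mul₀ hp).2 hq, hqK⟩
  have hupper : ∀ K : Set ℤ, IsLowerSet K → GeometricDecayOn (powerBlock N p a) K →
      ∃ q > 0, p⁻¹ * q < 1 ∧ UpperGrowth N (zpowHull a K) q := fun K hK hdecay =>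
    let ⟨q, hq0, hq, hqK⟩ := hdecay.exists_upperGrowth hN hp ha hK
    ⟨q, hq0, (inv_mul_lt_one₀ hp).2 hq, hqK⟩
  rcases hdom.geometric_trichotomy (powerBlock_nonneg hN hp ha) hθ with
    hgrowth | hdecay | ⟨m, hdecay, hgrowth⟩
  · have hK := hlower _ ordConnected_univ hgrowth
    rw [zpowHull_univ ha] at hK
    exact Or.inl ((orliczBeta_lt_iff hN hp').2 hK)
  · have hK := hupper _ isLowerSet_univ hdecay
    rw [zpowHull_univ ha] at hK
    exact Or.inr (Or.inl ((lt_orliczAlpha_iff hN hp'.le).2 hK))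
  · have ham : 0 < a ^ m := zpow_pos (one_pos.trans ha) m
    have hright := hlower _ ordConnected_Ici hgrowth
    have hleft := hupper _ (isLowerSet_Iic m) hdecay
    rw [zpowHull_Ici ha] at hright
    rw [zpowHull_Iic ha] at hleft
    exact Or.inr (Or.inr ⟨(orliczBetaZero_lt_iff hN hp' ham).2 hright,
      (lt_orliczAlphaInfty_iff hN hp'.le ham).2 hleft⟩)

end PowerBlocks

section Classification

variable {N : ℝ → ℝ} {p : ℝ≥0∞}

theorem symmFinitelyRepresented_top_iff (hN : IsOrliczFunction N) :
    SymmFinitelyRepresented N ∞ ↔ orliczAlpha N ≤ 0 := by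
  refine ⟨fun hF => ?_, symmFinitelyRepresented_top_of_orliczAlpha_nonpos hN⟩
  by_contra! hα
  obtain ⟨q, -, -, hq⟩ := (lt_orliczAlpha_iff hN le_rfl).1 hα
  exact hq.not_symmFinitelyRepresented_top hN hF

theorem symmFinitelyRepresented_iff_of_ne_top [Fact (1 ≤ p)] (hN : IsOrliczFunction N)
    (hp : p ≠ ∞) : SymmFinitelyRepresented N p ↔
      (p.toReal⁻¹ ≤ orliczBeta N ∧ orliczAlpha N ≤ p.toReal⁻¹) ∧
        (p.toReal⁻¹ ≤ orliczBetaZero N ∨ orliczAlphaInfty N ≤ p.toReal⁻¹) := by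
  have hp0 : 0 < p.toReal := ENNReal.toReal_pos (zero_lt_one.trans_le Fact.out).ne' hp
  constructor
  · refine fun hF => ⟨⟨?_, ?_⟩, ?_⟩ <;> by_contra! hsteep
    · exact (steepAround_of_orliczBeta_lt hN hp0 hsteep).not_symmFinitelyRepresented hN hp0 hF
    · exact (steepAround_of_lt_orliczAlpha hN hp0 hsteep).not_symmFinitelyRepresented hN hp0 hF
    · exact (steepAround_of_orliczBetaZero_lt_of_lt_orliczAlphaInfty hN hp0 hsteep.1
        hsteep.2).not_symmFinitelyRepresented hN hp0 hF
  · rintro ⟨⟨hβ, hα⟩, hβα⟩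
    refine HasBroadWindows.symmFinitelyRepresented hp ?_ hN
    by_contra hnarrow
    rcases indices_of_not_hasBroadWindows hN hp0 hnarrow with h | h | ⟨hl, hr⟩
    · exact h.not_ge hβ
    · exact h.not_ge hα
    · exact hβα.elim hl.not_ge hr.not_ge

theorem mem_symmReprSet_iff (hN : IsOrliczFunction N) : p ∈ symmReprSet N ↔
    (p⁻¹ ≤ ENNReal.ofReal (orliczBeta N) ∧ ENNReal.ofReal (orliczAlpha N) ≤ p⁻¹) ∧
      (p⁻¹ ≤ ENNReal.ofReal (orliczBetaZero N) ∨
        ENNReal.ofReal (orliczAlphaInfty N) ≤ p⁻¹) := by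
  have hβ0 := (orliczAlpha_nonneg hN).trans (orliczAlpha_le_orliczBetaZero hN)
  have hβ := hβ0.trans (orliczBetaZero_le_orliczBeta hN)
  rw [symmReprSet, mem_ofPred_eq]
  rcases lt_or_ge p 1 with hlt | hp1
  · refine iff_of_false (fun h => hlt.not_ge h.1) fun h => ?_
    have hle := h.1.1.trans (ENNReal.ofReal_le_one.2 (orliczBeta_le_one hN))
    exact hlt.not_ge (ENNReal.inv_le_one.1 hle)
  rw [and_iff_right hp1]
  rcases eq_or_ne p ∞ with rfl | hp
  · simp only [symmFinitelyRepresented_top_iff hN, ENNReal.inv_top, zero_le, true_and, true_or,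
      and_true, nonpos_iff_eq_zero, ENNReal.ofReal_eq_zero]
  · have : Fact (1 ≤ p) := ⟨hp1⟩
    have hp0 : 0 < p.toReal := ENNReal.toReal_pos (zero_lt_one.trans_le hp1).ne' hp
    have hinv : p⁻¹ = ENNReal.ofReal p.toReal⁻¹ := by
      rw [ENNReal.ofReal_inv_of_pos hp0, ENNReal.ofReal_toReal hp]
    have hinv0 := (inv_pos.2 hp0).le
    rw [symmFinitelyRepresented_iff_of_ne_top hN hp, hinv, ENNReal.ofReal_le_ofReal_iff hβ,
      ENNReal.ofReal_le_ofReal_iff hβ0, ENNReal.ofReal_le_ofReal_iff hinv0,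
      ENNReal.ofReal_le_ofReal_iff hinv0]

end Classification

theorem mainTheorem6_general (N : ℝ → ℝ) (hN : IsOrliczFunction N) :
    (orliczAlphaInfty N ≤ orliczBetaZero N →
      symmReprSet N =
        Icc (ENNReal.ofReal (orliczBeta N))⁻¹ (ENNReal.ofReal (orliczAlpha N))⁻¹) ∧
    (orliczBetaZero N < orliczAlphaInfty N →
      symmReprSet N =
        Icc (ENNReal.ofReal (orliczBeta N))⁻¹ (ENNReal.ofReal (orliczAlphaInfty N))⁻¹ ∪
        Icc (ENNReal.ofReal (orliczBetaZero N))⁻¹ (ENNReal.ofReal (orliczAlpha N))⁻¹) := by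
  have mem_Icc_inv_inv {p a b : ℝ≥0∞} : p ∈ Icc b⁻¹ a⁻¹ ↔ p⁻¹ ≤ b ∧ a ≤ p⁻¹ :=
    and_congr ENNReal.inv_le_iff_inv_le ENNReal.le_inv_iff_le_inv
  have hβ := ENNReal.ofReal_le_ofReal (orliczBetaZero_le_orliczBeta hN)
  have hα := ENNReal.ofReal_le_ofReal (orliczAlpha_le_orliczAlphaInfty hN)
  refine ⟨fun h => ?_, fun _ => ?_⟩ <;> ext p <;>
    simp only [mem_symmReprSet_iff hN, mem_union, mem_Icc_inv_inv]
  · have hcover := (le_total p⁻¹ (ENNReal.ofReal (orliczBetaZero N))).imp_right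
      (ENNReal.ofReal_le_ofReal h).trans
    exact and_iff_left hcover
  · constructor
    · rintro ⟨⟨hpβ, hpα⟩, hpβ0 | hpα'⟩
      exacts [Or.inr ⟨hpβ0, hpα⟩, Or.inl ⟨hpβ, hpα'⟩]
    · rintro (⟨hpβ, hpα'⟩ | ⟨hpβ0, hpα⟩)
      exacts [⟨⟨hpβ, hα.trans hpα'⟩, Or.inr hpα'⟩, ⟨⟨hpβ0.trans hβ, hpα⟩, Or.inl hpβ0⟩]

theorem mainTheorem6 (N : ℝ → ℝ) (hN : IsOrliczFunction N) (hα : 0 < orliczAlpha N) :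
    (orliczAlphaInfty N ≤ orliczBetaZero N →
      symmReprSet N =
        Icc (ENNReal.ofReal (1 / orliczBeta N)) (ENNReal.ofReal (1 / orliczAlpha N))) ∧
    (orliczBetaZero N < orliczAlphaInfty N →
      symmReprSet N =
        Icc (ENNReal.ofReal (1 / orliczBeta N)) (ENNReal.ofReal (1 / orliczAlphaInfty N)) ∪
        Icc (ENNReal.ofReal (1 / orliczBetaZero N)) (ENNReal.ofReal (1 / orliczAlpha N))) := by
  have hβ0 := hα.trans_le (orliczAlpha_le_orliczBetaZero hN)
  have hβ := hβ0.trans_le (orliczBetaZero_le_orliczBeta hN)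
  have hα' := hα.trans_le (orliczAlpha_le_orliczAlphaInfty hN)
  simpa only [one_div, ENNReal.ofReal_inv_of_pos, hα, hα', hβ, hβ0] using
    mainTheorem6_general N hN
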